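/- **Setting.** Let $G$ be a semisimple Lie group, $K\subset G$ a maximal compact subgroup, $G=KAN$ an Iwasawa decomposition, $g=k(g)a(g)n(g)$, $\mathfrak a=\mathrm{Lie}(A)$, $\mathfrak n=\mathrm{Lie}(N)$, $\rho(H)=\tfrac12\mathrm{Tr}(\mathrm{ad}(H)|_{\mathfrak n})$, and $M=Z_K(A)$. Give $\mathfrak a^*$ the norm induced by the Killing form; $\lambda\in\mathfrak a^*$ is *regular* if no non-trivial element of the Weyl group $N_K(A)/M$ fixes it. Let $\Gamma\subset G$ be a discrete, cocompact, torsion-free subgroup, and equip $\Gamma\backslash G$ with a non-zero finite right-$G$-invariant Borel measure. Let $(\kappa,V_\kappa)$ be an irreducible unitary representation of $M$, $(\tilde\kappa,V_{\tilde\kappa})$ its dual, and $(\gamma,V_\gamma)$ a finite-dimensional unitary representation of $K$. Inner products are conjugate linear in the first variable and $K$, $M$ carry normalized Haar measure. For $\lambda\in\mathfrak a^*$ let $H^{\kappa,i\lambda}=L^2(K\times_M V_\kappa)$ with $(\pi^{\kappa,i\lambda}(g)\phi)(k)=a(g^{-1}k)^{i\lambda-\rho}\phi(k(g^{-1}k))$.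 Let $A_\gamma=C(\Gamma\backslash G)\otimes\mathrm{End}(V_\gamma)$, with the $K$-action $(kf)(x)=\gamma(k)f(xk)\gamma(k)^{-1}$, and let $A_{\gamma,K}$ be its subalgebra of $K$-finite elements. For a unitary $G$-embedding $\xi:H^{\kappa,i\lambda}\to L^2(\Gamma\backslash G)$ and $K$-finite $\phi,\psi\in C^K(K\times_MV_\kappa)\otimes V_\gamma$ put $$\sigma^\xi_{\phi,\psi}(f)=\int_{\Gamma\backslash G}\langle \xi(\phi)(x),f(x)\,\xi(\psi)(x)\rangle\,dx ,\qquad f\in A_\gamma .$$ Let $L(\kappa)$ be the set of unit vectors $l\in\mathfrak a^*$ for which there are unitary embeddings $\xi_n:H^{\kappa,i\lambda_n}\to L^2(\Gamma\backslash G)$ with $\|\lambda_n\|\to\infty$ and $\lambda_n/\|\lambda_n\|\to l$. Such a sequence is *$l$-conveniently arranged* if moreover all $\lambda_n$ are regular and, for all $K$-finite $\phi,\psi$ as above, the functionals $\sigma^{\xi_n}_{\phi,\psi}$ converge weakly; the limit is denoted $\sigma_{\phi,\psi}$. For $T\in[V_\kappa\otimes V_\gamma]^M$ with $\|T\|=1$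 let $\psi_T$ be the $K$-invariant element of $C^\infty(K\times_MV_\kappa)\otimes V_\gamma$ with $\psi_T(1)=T$, let $\delta_T$ be the distribution $\phi\mapsto\langle T,\phi(1)\rangle$, and let $\delta_{T,\mu}$, $\mu\in\hat K$, be its $K$-isotypic components. For a regular $l\in L(\kappa)$ let $V(l,\kappa,\gamma,T)$ be the set of states $\sigma$ on $A_\gamma$ for which there is an $l$-conveniently arranged sequence such that $$\sigma(f)=\sum_{\mu\in\hat K}\sigma_{\psi_T,\delta_{T,\mu}}(f)\qquad (f\in A_{\gamma,K}),$$ where the sum is finite for each $f$. Regard $T$ as an operator $V_{\tilde\kappa}\to V_\gamma$ and set $P_T=1\otimes\dim(V_\kappa)TT^*\in A_\gamma$. **Proposition.** Let $l\in L(\kappa)$ be regular and $T\in[V_\kappa\otimes V_\gamma]^M$ with $\|T\|=1$. 0. $P_T$ is an $M$-invariant self-adjoint projection in $A_\gamma$. 1. Every $\sigma\in V(l,\kappa,\gamma,T)$ is $M$-invariant: $\sigma(mf)=\sigma(f)$ for all $m\in M$, $f\in A_\gamma$. 2. Every $\sigma\in V(l,\kappa,\gamma,T)$ satisfies $\sigma(P_TfP_T)=\sigma(f)$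 for all $f\in A_\gamma$. 3. The map $\Phi(f)(x)=\dim(V_\kappa)\,T^*f(x)T$ is a $*$-isomorphism from $P_TA_\gamma^MP_T$ onto the algebra $C(\Gamma\backslash G\times_M\mathrm{End}(V_{\tilde\kappa}))$ of continuous sections (the $M$-invariants in $C(\Gamma\backslash G)\otimes\mathrm{End}(V_{\tilde\kappa})$), and for every $\sigma\in V(l,\kappa,\gamma,T)$ there is a unique state $\sigma^0$ on this algebra with $$\sigma(f)=\sigma^0\Bigl(\Phi\Bigl(P_T\Bigl(\int_M mf\,dm\Bigr)P_T\Bigr)\Bigr)\qquad (f\in A_\gamma).$$ 4. If $l'\in L(\kappa)$ is regular and $T'\in[V_\kappa\otimes V_\gamma]^M$ with $\|T'\|=1$ is linearly independent of $T$, then $V(l,\kappa,\gamma,T)\cap V(l',\kappa,\gamma,T')=\emptyset$. -/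

import Mathlib

open scoped Manifold ContDiff TensorProduct ComplexOrder
open MeasureTheory Filter Topology

namespace RepLift

/-! ### Unitary representations and dual spaces -/

section Reps

/-- A strongly continuous unitary representation of a topological group on `V`. -/
structure UnitaryRep (H : Type*) [Group H] [TopologicalSpace H]
    (V : Type*) [NormedAddCommGroup V] [InnerProductSpace ℂ V] where
  toHom : H →* (V ≃ₗᵢ[ℂ] V)
  continuous' : ∀ v : V, Continuous fun h => toHom h v

variable {H : Type*} [Group H] [TopologicalSpace H]
  {V : Type*} [NormedAddCommGroup V] [InnerProductSpace ℂ V]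

/-- Irreducibility of a (finite-dimensional) unitary representation. -/
def UnitaryRep.IsIrreducible (π : UnitaryRep H V) : Prop :=
  Nontrivial V ∧ ∀ W : Submodule ℂ V, (∀ h, ∀ w ∈ W, π.toHom h w ∈ W) → W = ⊥ ∨ W = ⊤

/-- The unitary dual of a compact group, an equivalence class of irreducible representations being
represented by its character. -/
def UnitaryDual (H : Type*) [Group H] [TopologicalSpace H] : Type _ :=
  {χ : H → ℂ // ∃ (n : ℕ) (π : UnitaryRep H (EuclideanSpace ℂ (Fin n))), π.IsIrreducible ∧
    ∀ h, χ h = LinearMap.trace ℂ (EuclideanSpace ℂ (Fin n))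
      ((π.toHom h).toLinearEquiv : EuclideanSpace ℂ (Fin n) →ₗ[ℂ] EuclideanSpace ℂ (Fin n))}

variable [CompleteSpace V]

/-- The dual of a Hilbert space, with its dual norm. -/
def DualSpace (V : Type*) [NormedAddCommGroup V] [InnerProductSpace ℂ V] : Type _ :=
  StrongDual ℂ V

noncomputable instance : NormedAddCommGroup (DualSpace V) :=
  inferInstanceAs (NormedAddCommGroup (StrongDual ℂ V))

noncomputable instance : NormedSpace ℂ (DualSpace V) :=
  inferInstanceAs (NormedSpace ℂ (StrongDual ℂ V))

/-- The Riesz isomorphism `v ↦ ⟨v, ·⟩`. -/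
noncomputable def riesz : V ≃ DualSpace V := (InnerProductSpace.toDual ℂ V).toEquiv

/-- The Hilbert space structure of the dual of a Hilbert space (its norm is the dual norm). -/
noncomputable instance : InnerProductSpace ℂ (DualSpace V) where
  inner a b := inner ℂ (riesz.symm b) (riesz.symm a)
  norm_sq_eq_re_inner a := by
    rw [inner_self_eq_norm_sq]
    exact congrArg (· ^ 2) ((InnerProductSpace.toDual ℂ V).symm.norm_map a).symm
  conj_inner_symm a b := inner_conj_symm _ _
  add_left a b c := by
    have h : (riesz (V := V)).symm (a + b) = riesz.symm a + riesz.symm b :=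
      map_add (InnerProductSpace.toDual ℂ V).symm a b
    rw [h, inner_add_right]
  smul_left a b r := by
    have h : (riesz (V := V)).symm (r • a) = (starRingEnd ℂ r) • riesz.symm a :=
      (InnerProductSpace.toDual ℂ V).symm.map_smulₛₗ r a
    rw [h, inner_smul_right]

instance : CompleteSpace (DualSpace V) := inferInstanceAs (CompleteSpace (StrongDual ℂ V))

instance [FiniteDimensional ℂ V] : FiniteDimensional ℂ (DualSpace V) :=
  inferInstanceAs (FiniteDimensional ℂ (V →L[ℂ] ℂ))

/-- The operators of the dual (contragredient) representation: `ℓ ↦ ℓ ∘ π(h)⁻¹`. -/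
noncomputable def UnitaryRep.dual (π : UnitaryRep H V) (h : H) :
    DualSpace V ≃ₗᵢ[ℂ] DualSpace V where
  toFun ℓ := ContinuousLinearMap.comp (show StrongDual ℂ V from ℓ)
    (π.toHom h).symm.toContinuousLinearEquiv.toContinuousLinearMap
  invFun ℓ := ContinuousLinearMap.comp (show StrongDual ℂ V from ℓ)
    (π.toHom h).toContinuousLinearEquiv.toContinuousLinearMap
  left_inv ℓ := ContinuousLinearMap.ext fun v =>
    congrArg (show StrongDual ℂ V from ℓ) ((π.toHom h).symm_apply_apply v)
  right_inv ℓ := ContinuousLinearMap.ext fun v =>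
    congrArg (show StrongDual ℂ V from ℓ) ((π.toHom h).apply_symm_apply v)
  map_add' _ _ := rfl
  map_smul' _ _ := rfl
  norm_map' ℓ := ContinuousLinearMap.opNorm_comp_linearIsometryEquiv
    (show StrongDual ℂ V from ℓ) (π.toHom h).symm

end Reps

/-! ### States -/

/-- States: normalized positive functionals. -/
def IsState {A : Type*} [Semiring A] [StarRing A] [Algebra ℂ A] [TopologicalSpace A]
    (σ : A →L[ℂ] ℂ) : Prop :=
  σ 1 = 1 ∧ ∀ a : A, 0 ≤ σ (star a * a)

/-! ### Lie groups and Iwasawa decompositions -/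

section Lie

variable {E : Type*} [NormedAddCommGroup E] [NormedSpace ℝ E]
  {G : Type*} [TopologicalSpace G] [ChartedSpace E G] [Group G] [LieGroup 𝓘(ℝ, E) ∞ G]

instance lieGroupMinSmoothness : LieGroup 𝓘(ℝ, E) (minSmoothness ℝ 3) G :=
  LieGroup.of_le (n := ∞) (by
    rw [minSmoothness_of_isRCLikeNormedField]; exact WithTop.coe_le_coe.mpr (le_top : (3 : ℕ∞) ≤ ⊤))

/-- `γ` is the one-parameter subgroup `t ↦ exp (t X)`, i.e. the integral curve through `1` of the
left-invariant vector field of `X`. -/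
def IsOneParam (X : GroupLieAlgebra 𝓘(ℝ, E) G) (γ : ℝ → G) : Prop :=
  γ 0 = 1 ∧ IsMIntegralCurve (I := 𝓘(ℝ, E)) γ (mulInvariantVectorField X)

/-- `g = exp X`. -/
def IsExp (X : GroupLieAlgebra 𝓘(ℝ, E) G) (g : G) : Prop :=
  ∃ γ : ℝ → G, IsOneParam X γ ∧ γ 1 = g

variable (E G) [CompleteSpace E]

/-- An Iwasawa decomposition `G = KAN` of a semisimple Lie group: `K` is a maximal compact
subgroup whose Lie algebra is the fixed space of a Cartan involution `θ`, `𝔞` is a maximal abelian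
subspace of the `-1`-eigenspace of `θ`, the element `H₀` fixes a positive Weyl chamber in `𝔞`,
`𝔫` (defined below) is the sum of the root spaces which are positive for this chamber,
`A = exp 𝔞` and `N = exp 𝔫`. -/
structure IwasawaData where
  K : Subgroup G
  isCompact_K : IsCompact (K : Set G)
  maximal_K : ∀ K' : Subgroup G, IsCompact (K' : Set G) → K ≤ K' → K' = K
  θ : GroupLieAlgebra 𝓘(ℝ, E) G →ₗ⁅ℝ⁆ GroupLieAlgebra 𝓘(ℝ, E) G
  θ_involutive : ∀ X, θ (θ X) = X
  θ_neg : ∀ X, X ≠ 0 → killingForm ℝ (GroupLieAlgebra 𝓘(ℝ, E) G) X (θ X) < 0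
  mem_lieK : ∀ X, θ X = X ↔ ∃ γ : ℝ → G, IsOneParam X γ ∧ ∀ t, γ t ∈ K
  𝔞 : Submodule ℝ (GroupLieAlgebra 𝓘(ℝ, E) G)
  θ_𝔞 : ∀ H : 𝔞, θ H = -(H : GroupLieAlgebra 𝓘(ℝ, E) G)
  lie_𝔞 : ∀ H H' : GroupLieAlgebra 𝓘(ℝ, E) G, H ∈ 𝔞 → H' ∈ 𝔞 → ⁅H, H'⁆ = 0
  maximal_𝔞 : ∀ X : GroupLieAlgebra 𝓘(ℝ, E) G,
    θ X = -X → (∀ H : 𝔞, ⁅(H : GroupLieAlgebra 𝓘(ℝ, E) G), X⁆ = 0) → X ∈ 𝔞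
  H₀ : 𝔞
  /-- No root vanishes at `H₀`: the centralizer of `H₀` is that of `𝔞`. -/
  H₀_regular : ∀ X : GroupLieAlgebra 𝓘(ℝ, E) G, ⁅(H₀ : GroupLieAlgebra 𝓘(ℝ, E) G), X⁆ = 0 →
    ∀ H : 𝔞, ⁅(H : GroupLieAlgebra 𝓘(ℝ, E) G), X⁆ = 0
  A : Subgroup G
  mem_A : ∀ g, g ∈ A ↔ ∃ X ∈ 𝔞, IsExp X g
  N : Subgroup G
  mem_N : ∀ g, g ∈ N ↔ ∃ X ∈ Submodule.span ℝ {X : GroupLieAlgebra 𝓘(ℝ, E) G |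
    ∃ α : Module.Dual ℝ 𝔞, 0 < α H₀ ∧ ∀ H : 𝔞, ⁅(H : GroupLieAlgebra 𝓘(ℝ, E) G), X⁆ = α H • X},
    IsExp X g
  decomp : ∀ g : G, ∃! p : K × A × N, g = (p.1 : G) * (p.2.1 : G) * (p.2.2 : G)

variable {E G}

namespace IwasawaData

variable (D : IwasawaData E G)

/-- The sum of the positive restricted root spaces. -/
noncomputable def 𝔫 : Submodule ℝ (GroupLieAlgebra 𝓘(ℝ, E) G) :=
  Submodule.span ℝ {X : GroupLieAlgebra 𝓘(ℝ, E) G | ∃ α : Module.Dual ℝ D.𝔞,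
    0 < α D.H₀ ∧ ∀ H : D.𝔞, ⁅(H : GroupLieAlgebra 𝓘(ℝ, E) G), X⁆ = α H • X}

theorem ad_mem_𝔫 (H : D.𝔞) :
    ∀ X ∈ D.𝔫, LieAlgebra.ad ℝ (GroupLieAlgebra 𝓘(ℝ, E) G) (H : GroupLieAlgebra 𝓘(ℝ, E) G) X
      ∈ D.𝔫 := by
  intro X hX
  rw [LieAlgebra.ad_apply]
  unfold 𝔫 at hX ⊢
  induction hX using Submodule.span_induction with
  | mem x hx =>
    obtain ⟨α, h0, h⟩ := hx
    rw [h H]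
    exact Submodule.smul_mem _ _ (Submodule.subset_span ⟨α, h0, h⟩)
  | zero => rw [lie_zero]; exact Submodule.zero_mem _
  | add x y _ _ hx hy => rw [lie_add]; exact Submodule.add_mem _ hx hy
  | smul a x _ hx => rw [lie_smul]; exact Submodule.smul_mem _ _ hx

/-- `ρ(H) = ½ tr (ad H restricted to 𝔫)`. -/
noncomputable def rho (H : D.𝔞) : ℝ :=
  (1 / 2) * LinearMap.trace ℝ D.𝔫
    ((LieAlgebra.ad ℝ (GroupLieAlgebra 𝓘(ℝ, E) G) (H : GroupLieAlgebra 𝓘(ℝ, E) G)).restrict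
      (D.ad_mem_𝔫 H))

/-- The norm on `𝔞*` dual to the Euclidean norm given on `𝔞` by the Killing form. -/
noncomputable def dualNorm (l : Module.Dual ℝ D.𝔞) : ℝ :=
  sSup {r | ∃ H : D.𝔞, killingForm ℝ (GroupLieAlgebra 𝓘(ℝ, E) G) H H ≤ 1 ∧ r = l H}

/-- The logarithm `A → 𝔞`. -/
noncomputable def log (a : D.A) : D.𝔞 :=
  ⟨((D.mem_A a).1 a.2).choose, ((D.mem_A a).1 a.2).choose_spec.1⟩

/-- The components `k(g)` and `a(g)` of `g = k(g) a(g) n(g)`. -/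
noncomputable def kPart (g : G) : D.K := (D.decomp g).choose.1

noncomputable def aPart (g : G) : D.A := (D.decomp g).choose.2.1

/-- `M = Z_K(A)`, as a subgroup of `K`. -/
def M : Subgroup D.K := (Subgroup.centralizer (D.A : Set G)).subgroupOf D.K

/-- `l ∈ 𝔞*` is regular: it is fixed by no nontrivial element of the Weyl group `N_K(A)/M`.
An element `k ∈ N_K(A)` fixes `l` iff `l ∘ log` is invariant under conjugation by `k` on `A`. -/
def IsRegular (l : Module.Dual ℝ D.𝔞) : Prop :=
  ∀ k : D.K, (∀ g : G, g ∈ D.A ↔ (k : G) * g * (k : G)⁻¹ ∈ D.A) →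
    (∀ a a' : D.A, (a' : G) = (k : G) * (a : G) * (k : G)⁻¹ → l (D.log a') = l (D.log a)) →
    k ∈ D.M

instance compactSpace_K : CompactSpace D.K := isCompact_iff_compactSpace.mp D.isCompact_K

instance compactSpace_M [T2Space G] [IsTopologicalGroup G] : CompactSpace D.M := by
  have hc : IsClosed (D.M : Set D.K) :=
    (Set.isClosed_centralizer (D.A : Set G)).preimage continuous_subtype_val
  exact isCompact_iff_compactSpace.mp hc.isCompact

instance [SecondCountableTopology G] : SecondCountableTopology D.K :=
  TopologicalSpace.Subtype.secondCountableTopology (D.K : Set G)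

instance [SecondCountableTopology G] : SecondCountableTopology D.M :=
  TopologicalSpace.Subtype.secondCountableTopology (D.M : Set D.K)

variable [IsTopologicalGroup G] [MeasurableSpace G] [BorelSpace G]

/-- The normalized Haar measure of `K`. -/
noncomputable def haarK : Measure D.K := Measure.haarMeasure ⊤

/-- The normalized Haar measure of `M`. -/
noncomputable def haarM [T2Space G] : Measure D.M := Measure.haarMeasure ⊤

instance : D.haarK.IsHaarMeasure := by unfold haarK; infer_instance

end IwasawaData

end Lie

/-! ### The space `Γ\G` -/

section Quot

variable {G : Type*} [Group G] [TopologicalSpace G]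

/-- `Γ\G`. -/
def RightCosets (Γ : Subgroup G) : Type _ := Quotient (QuotientGroup.rightRel Γ)

variable (Γ : Subgroup G)

instance : TopologicalSpace (RightCosets Γ) :=
  inferInstanceAs (TopologicalSpace (Quotient (QuotientGroup.rightRel Γ)))

instance : MeasurableSpace (RightCosets Γ) := borel _

instance : BorelSpace (RightCosets Γ) := ⟨rfl⟩

variable {Γ}

/-- Right translation `Γx ↦ Γxg`. -/
def RightCosets.mulRight (g : G) : RightCosets Γ → RightCosets Γ :=
  Quotient.map (· * g) (by
    intro a b h
    have h' := QuotientGroup.rightRel_apply.mp h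
    exact QuotientGroup.rightRel_apply.mpr (by simpa [mul_assoc] using h'))

theorem RightCosets.continuous_mulRight [IsTopologicalGroup G] (g : G) :
    Continuous (RightCosets.mulRight (Γ := Γ) g) :=
  Continuous.quotient_map' (continuous_mul_const g) _

variable {V : Type*} [NormedAddCommGroup V] [InnerProductSpace ℂ V]

/-- For `g : G` and a unitary `u` of `V` the transformation `f ↦ u f(· g) u⁻¹` of
`C(Γ\G) ⊗ End(V) = C(Γ\G, End(V))`. -/
noncomputable def act [IsTopologicalGroup G] (g : G) (u : V ≃ₗᵢ[ℂ] V)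
    (f : C(RightCosets Γ, V →L[ℂ] V)) : C(RightCosets Γ, V →L[ℂ] V) where
  toFun x := (u.toContinuousLinearEquiv.toContinuousLinearMap.comp (f (x.mulRight g))).comp
    u.symm.toContinuousLinearEquiv.toContinuousLinearMap
  continuous_toFun := by
    have h := f.continuous.comp (RightCosets.continuous_mulRight (Γ := Γ) g)
    exact (continuous_const.clm_comp h).clm_comp continuous_const

section ActLemmas

variable [IsTopologicalGroup G] (g : G) (u : V ≃ₗᵢ[ℂ] V) (f f' : C(RightCosets Γ, V →L[ℂ] V))

theorem act_apply (x : RightCosets Γ) (v : V) :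
    act g u f x v = u (f (x.mulRight g) (u.symm v)) := rfl

theorem act_mul : act g u (f * f') = act g u f * act g u f' := by
  ext x v; simp [act_apply]

theorem act_add : act g u (f + f') = act g u f + act g u f' := by
  ext x v; simp [act_apply]

theorem act_smul (c : ℂ) : act g u (c • f) = c • act g u f := by
  ext x v; simp [act_apply]

theorem act_zero : act g u (0 : C(RightCosets Γ, V →L[ℂ] V)) = 0 := by
  ext x v; simp [act_apply]

theorem act_one : act g u (1 : C(RightCosets Γ, V →L[ℂ] V)) = 1 := by
  ext x v; simp [act_apply]

theorem act_star [CompleteSpace V] : act g u (star f) = star (act g u f) := by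
  ext x v
  refine ext_inner_left ℂ fun w => ?_
  rw [ContinuousMap.star_apply, ContinuousLinearMap.star_eq_adjoint,
    ContinuousLinearMap.adjoint_inner_right, act_apply, act_apply, ContinuousMap.star_apply,
    ContinuousLinearMap.star_eq_adjoint]
  rw [← u.symm.inner_map_map w, u.symm_apply_apply, ContinuousLinearMap.adjoint_inner_right,
    ← u.inner_map_map, u.apply_symm_apply]

end ActLemmas

end Quot

/-! ### Principal series -/

section Principal

variable {E : Type*} [NormedAddCommGroup E] [NormedSpace ℝ E] [CompleteSpace E]
  {G : Type*} [TopologicalSpace G] [ChartedSpace E G] [Group G] [LieGroup 𝓘(ℝ, E) ∞ G]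
  [IsTopologicalGroup G] [MeasurableSpace G] [BorelSpace G] [SecondCountableTopology G]
  {D : IwasawaData E G}
  {Vκ : Type*} [NormedAddCommGroup Vκ] [InnerProductSpace ℂ Vκ] [FiniteDimensional ℂ Vκ]
  {Vγ : Type*} [NormedAddCommGroup Vγ] [InnerProductSpace ℂ Vγ] [FiniteDimensional ℂ Vγ]
  (κ : UnitaryRep D.M Vκ) (γ : UnitaryRep D.K Vγ)

/-- `L²(K ×_M V_κ)`, the space of all the `H^{κ,iλ}` in the compact picture. -/
noncomputable def principalSpace : Submodule ℂ (Lp Vκ 2 D.haarK) where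
  carrier := {φ | ∀ m : D.M, ∀ᵐ k ∂D.haarK, φ (k * (m : D.K)) = κ.toHom m⁻¹ (φ k)}
  add_mem' {a b} ha hb m := by
    have hq := (quasiMeasurePreserving_mul_right D.haarK (m : D.K)).ae (Lp.coeFn_add a b)
    filter_upwards [ha m, hb m, Lp.coeFn_add a b, hq] with k h1 h2 h3 h4
    rw [h4, h3, Pi.add_apply, Pi.add_apply, map_add, h1, h2]
  zero_mem' m := by
    have hq := (quasiMeasurePreserving_mul_right D.haarK (m : D.K)).ae
      (Lp.coeFn_zero Vκ 2 D.haarK)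
    filter_upwards [Lp.coeFn_zero Vκ 2 D.haarK, hq] with k h3 h4
    rw [h4, h3]; simp
  smul_mem' c a ha m := by
    have hq := (quasiMeasurePreserving_mul_right D.haarK (m : D.K)).ae (Lp.coeFn_smul c a)
    filter_upwards [ha m, Lp.coeFn_smul c a, hq] with k h1 h3 h4
    rw [h4, h3, Pi.smul_apply, Pi.smul_apply, map_smul, h1]

/-- `φ' = π^{κ,iλ}(g) φ`, i.e. `φ'(k) = a(g⁻¹k)^{iλ-ρ} φ(k(g⁻¹k))`. -/
def IsPrincipalAction (l : Module.Dual ℝ D.𝔞) (g : G) (φ φ' : principalSpace κ) : Prop :=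
  ∀ᵐ k ∂D.haarK, (φ' : Lp Vκ 2 D.haarK) k =
    Complex.exp (Complex.I * (l (D.log (D.aPart (g⁻¹ * (k : G)))) : ℝ)
      - (D.rho (D.log (D.aPart (g⁻¹ * (k : G)))) : ℝ)) •
      (φ : Lp Vκ 2 D.haarK) (D.kPart (g⁻¹ * (k : G)))

/-- `ξ` is a unitary embedding `H^{κ,iλ} → L²(Γ\G)` of representations of `G`. -/
def IsEmbedding {Γ : Subgroup G} {ν : Measure (RightCosets Γ)} (l : Module.Dual ℝ D.𝔞)
    (ξ : principalSpace κ →ₗᵢ[ℂ] Lp ℂ 2 ν) : Prop :=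
  ∀ (g : G) (φ φ' : principalSpace κ), IsPrincipalAction κ l g φ φ' →
    ∀ᵐ x ∂ν, ξ φ' x = ξ φ (x.mulRight g)

variable (Vγ) in
/-- The continuous sections of `(K ×_M V_κ) ⊗ V_γ`: functions `φ : K → V_κ ⊗ V_γ` with
`φ(km) = (κ(m)⁻¹ ⊗ 1) φ(k)`. -/
noncomputable def sections : Submodule ℂ C(D.K, Vκ ⊗[ℂ] Vγ) where
  carrier := {φ | ∀ (m : D.M) (k : D.K), φ (k * (m : D.K)) =
    LinearMap.rTensor Vγ ((κ.toHom m⁻¹).toLinearEquiv : Vκ →ₗ[ℂ] Vκ) (φ k)}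
  add_mem' {a b} ha hb m k := by
    simp only [ContinuousMap.add_apply, map_add]; rw [ha m k, hb m k]
  zero_mem' m k := by simp
  smul_mem' c a ha m k := by
    simp only [ContinuousMap.smul_apply, map_smul]; rw [ha m k]

/-- Left translation by `h : K` of functions on `K`: `(h φ)(k) = φ(h⁻¹k)`. -/
def leftTranslate {W : Type*} [TopologicalSpace W] (h : D.K) (φ : C(D.K, W)) : C(D.K, W) :=
  φ.comp ⟨fun k => h⁻¹ * k, continuous_const_mul h⁻¹⟩

variable {κ} in
/-- `φ ∈ C^K(K ×_M V_κ) ⊗ V_γ` (a `K`-finite continuous section is automatically smooth). -/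
def IsKFiniteSection (φ : sections Vγ κ) : Prop :=
  FiniteDimensional ℂ (Submodule.span ℂ
    (Set.range fun h : D.K => leftTranslate h (φ : C(D.K, Vκ ⊗[ℂ] Vγ))))

variable (Vκ) in
/-- The contraction `1 ⊗ ⟨w, ·⟩ : V_κ ⊗ V_γ → V_κ`. -/
noncomputable def slice (w : Vγ) : Vκ ⊗[ℂ] Vγ →ₗ[ℂ] Vκ :=
  (TensorProduct.rid ℂ Vκ).toLinearMap ∘ₗ
    LinearMap.lTensor Vκ (innerSL ℂ w : Vγ →ₗ[ℂ] ℂ)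

theorem slice_rTensor (w : Vγ) (u : Vκ →ₗ[ℂ] Vκ) (t : Vκ ⊗[ℂ] Vγ) :
    slice Vκ w (LinearMap.rTensor Vγ u t) = u (slice Vκ w t) := by
  induction t using TensorProduct.induction_on with
  | zero => simp
  | tmul a b => simp [slice]
  | add a b ha hb => simp [ha, hb]

theorem continuous_slice (w : Vγ) : Continuous (slice Vκ w) :=
  LinearMap.continuous_of_finiteDimensional _

variable {κ} in
/-- The `w`-component of a section, as an element of `L²(K ×_M V_κ)`. -/
noncomputable def component (w : Vγ) (φ : sections Vγ κ) : principalSpace κ :=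
  ⟨ContinuousMap.toLp 2 D.haarK ℂ
      ⟨fun k => slice Vκ w ((φ : C(D.K, Vκ ⊗[ℂ] Vγ)) k),
        (continuous_slice w).comp (φ : C(D.K, Vκ ⊗[ℂ] Vγ)).continuous⟩, by
    intro m
    set F : C(D.K, Vκ) := ⟨fun k => slice Vκ w ((φ : C(D.K, Vκ ⊗[ℂ] Vγ)) k),
        (continuous_slice w).comp (φ : C(D.K, Vκ ⊗[ℂ] Vγ)).continuous⟩ with hF
    have h := ContinuousMap.coeFn_toLp (p := 2) (𝕜 := ℂ) D.haarK F
    have hq := (quasiMeasurePreserving_mul_right D.haarK (m : D.K)).ae h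
    filter_upwards [h, hq] with k h1 h2
    rw [h1, h2]
    change slice Vκ w _ = κ.toHom m⁻¹ (slice Vκ w _)
    rw [φ.2 m k, slice_rTensor]
    rfl⟩

variable {κ} in
/-- `(ξ ⊗ 1) φ`, a function on `Γ\G` with values in `V_γ`. -/
noncomputable def embed {Γ : Subgroup G} {ν : Measure (RightCosets Γ)}
    (ξ : principalSpace κ →ₗᵢ[ℂ] Lp ℂ 2 ν) (φ : sections Vγ κ) (x : RightCosets Γ) : Vγ :=
  ∑ i, (ξ (component (stdOrthonormalBasis ℂ Vγ i) φ) x) • stdOrthonormalBasis ℂ Vγ i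

variable {κ} in
/-- `σ^ξ_{φ,ψ}(f) = ∫_{Γ\G} ⟨ξ(φ)(x), f(x) ξ(ψ)(x)⟩ dx`. -/
noncomputable def sigma {Γ : Subgroup G} {ν : Measure (RightCosets Γ)}
    (ξ : principalSpace κ →ₗᵢ[ℂ] Lp ℂ 2 ν) (φ ψ : sections Vγ κ)
    (f : C(RightCosets Γ, Vγ →L[ℂ] Vγ)) : ℂ :=
  ∫ x, inner ℂ (embed ξ φ x) (f x (embed ξ ψ x)) ∂ν

/-- The invariants `[V_κ ⊗ V_γ]^M`. -/
noncomputable def invariants : Submodule ℂ (Vκ ⊗[ℂ] Vγ) where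
  carrier := {T | ∀ m : D.M, TensorProduct.map ((κ.toHom m).toLinearEquiv : Vκ →ₗ[ℂ] Vκ)
    ((γ.toHom (m : D.K)).toLinearEquiv : Vγ →ₗ[ℂ] Vγ) T = T}
  add_mem' {a b} ha hb m := by rw [map_add, ha m, hb m]
  zero_mem' m := by simp
  smul_mem' c a ha m := by rw [map_smul, ha m]

variable {κ γ}

theorem continuous_lTensor (T : Vκ ⊗[ℂ] Vγ) : Continuous fun k : D.K =>
    LinearMap.lTensor Vκ ((γ.toHom k).toLinearEquiv : Vγ →ₗ[ℂ] Vγ) T := by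
  induction T using TensorProduct.induction_on with
  | zero => simpa using continuous_const
  | tmul v w =>
    simp only [LinearMap.lTensor_tmul]
    exact (TensorProduct.mkL ℂ Vκ Vγ v).continuous.comp (γ.continuous' w)
  | add a b ha hb => simp only [map_add]; exact ha.add hb

/-- The `K`-invariant section `ψ_T` with `ψ_T(1) = T`, i.e. `ψ_T(k) = (1 ⊗ γ(k)) T`. -/
noncomputable def psi (T : invariants κ γ) : sections Vγ κ :=
  ⟨⟨fun k => LinearMap.lTensor Vκ ((γ.toHom k).toLinearEquiv : Vγ →ₗ[ℂ] Vγ)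
      (T : Vκ ⊗[ℂ] Vγ), continuous_lTensor _⟩, by
    intro m k
    change LinearMap.lTensor Vκ ((γ.toHom (k * (m : D.K))).toLinearEquiv : Vγ →ₗ[ℂ] Vγ) _ =
      LinearMap.rTensor Vγ _ (LinearMap.lTensor Vκ _ _)
    conv_rhs => rw [← T.2 m]
    generalize (T : Vκ ⊗[ℂ] Vγ) = t
    induction t using TensorProduct.induction_on with
    | zero => simp
    | tmul v w => simp
    | add a b ha hb => simp only [map_add, ha, hb]⟩

/-- The distribution `δ_T : φ ↦ ⟨T, φ(1)⟩`. -/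
noncomputable def delta (T : invariants κ γ) (φ : sections Vγ κ) : ℂ :=
  inner ℂ (T : Vκ ⊗[ℂ] Vγ) ((φ : C(D.K, Vκ ⊗[ℂ] Vγ)) 1)

/-- `φ` lies in the isotypic component of the `K`-type with character `χ`:
`φ = χ(1) ∫_K conj(χ(h)) (h φ) dh`. -/
def IsIsotypic (χ : UnitaryDual D.K) (φ : sections Vγ κ) : Prop :=
  ∀ k : D.K, (φ : C(D.K, Vκ ⊗[ℂ] Vγ)) k = χ.1 1 •
    ∫ h, (starRingEnd ℂ (χ.1 h)) • (φ : C(D.K, Vκ ⊗[ℂ] Vγ)) (h⁻¹ * k) ∂D.haarK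

/-- `ψ` is the component in the `χ`-isotypic subspace of a distribution `d`, where a section `ψ`
is identified with the distribution `φ ↦ ∫_K ⟨ψ(k), φ(k)⟩ dk`. -/
def IsIsotypicPart (d : sections Vγ κ → ℂ) (χ : UnitaryDual D.K) (ψ : sections Vγ κ) : Prop :=
  IsKFiniteSection ψ ∧ IsIsotypic χ ψ ∧ ∀ φ : sections Vγ κ, IsIsotypic χ φ →
    ∫ k, inner ℂ ((ψ : C(D.K, Vκ ⊗[ℂ] Vγ)) k) ((φ : C(D.K, Vκ ⊗[ℂ] Vγ)) k) ∂D.haarK = d φ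

/-! ### Representation theoretic lifts -/

variable {Γ : Subgroup G}

variable (γ) in
/-- `f ∈ A_{γ,K}`: `f` is a `K`-finite element of `A_γ`. -/
def IsKFinite (f : C(RightCosets Γ, Vγ →L[ℂ] Vγ)) : Prop :=
  FiniteDimensional ℂ (Submodule.span ℂ
    (Set.range fun k : D.K => act (k : G) (γ.toHom k) f))

variable (κ) in
/-- A sequence of unitary embeddings `ξ_n : H^{κ,iλ_n} → L²(Γ\G)` such that `λ_n → ∞` and
`[λ_n] → l`, where rays are identified with points of the unit sphere of `𝔞*`. -/
structure IsEmbeddingSequence {ν : Measure (RightCosets Γ)} (l : Module.Dual ℝ D.𝔞)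
    (lam : ℕ → Module.Dual ℝ D.𝔞) (ξ : ℕ → principalSpace κ →ₗᵢ[ℂ] Lp ℂ 2 ν) : Prop where
  embedding : ∀ n, IsEmbedding κ (lam n) (ξ n)
  tendsto_norm : Tendsto (fun n => D.dualNorm (lam n)) atTop atTop
  tendsto_ray : ∀ H : D.𝔞, Tendsto (fun n => lam n H / D.dualNorm (lam n)) atTop (𝓝 (l H))

variable (κ) in
/-- The set `L(κ)` of rays, as a subset of the unit sphere of `𝔞*`. -/
def limitRays (ν : Measure (RightCosets Γ)) : Set (Module.Dual ℝ D.𝔞) :=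
  {l | D.dualNorm l = 1 ∧ ∃ (lam : ℕ → Module.Dual ℝ D.𝔞)
    (ξ : ℕ → principalSpace κ →ₗᵢ[ℂ] Lp ℂ 2 ν), IsEmbeddingSequence κ l lam ξ}

variable (Vγ) in
/-- `l`-conveniently arranged sequences. -/
structure IsConvenient {ν : Measure (RightCosets Γ)} (l : Module.Dual ℝ D.𝔞)
    (lam : ℕ → Module.Dual ℝ D.𝔞) (ξ : ℕ → principalSpace κ →ₗᵢ[ℂ] Lp ℂ 2 ν) : Prop
    extends IsEmbeddingSequence κ l lam ξ where
  regular : ∀ n, D.IsRegular (lam n)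
  weak_limit : ∀ φ ψ : sections Vγ κ, IsKFiniteSection φ → IsKFiniteSection ψ →
    ∃ s : C(RightCosets Γ, Vγ →L[ℂ] Vγ) →L[ℂ] ℂ,
      ∀ f, Tendsto (fun n => sigma (ξ n) φ ψ f) atTop (𝓝 (s f))

/-- `σ_{φ,ψ}(f) = lim_n σ^{ξ_n}_{φ,ψ}(f)`. -/
noncomputable def sigmaLim {ν : Measure (RightCosets Γ)}
    (ξ : ℕ → principalSpace κ →ₗᵢ[ℂ] Lp ℂ 2 ν)
    (φ ψ : sections Vγ κ) (f : C(RightCosets Γ, Vγ →L[ℂ] Vγ)) : ℂ :=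
  limUnder atTop fun n => sigma (ξ n) φ ψ f

/-- The set `V(l,κ,γ,T)` of representation theoretic lifts: the states on `A_γ` which on
`K`-finite elements `f` are given by `σ_T(f) = σ_{ψ_T,δ_T}(f) = ∑_χ σ_{ψ_T,δ_{T,χ}}(f)`
for some `l`-conveniently arranged sequence; here `δ_{T,χ}` are the isotypic components of
`δ_T`, and only finitely many terms of the sum are nonzero. -/
def lifts [CompleteSpace Vγ] (ν : Measure (RightCosets Γ)) (l : Module.Dual ℝ D.𝔞) (T : invariants κ γ) :
    Set (C(RightCosets Γ, Vγ →L[ℂ] Vγ) →L[ℂ] ℂ) :=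
  {σ | IsState σ ∧ ∃ (lam : ℕ → Module.Dual ℝ D.𝔞)
    (ξ : ℕ → principalSpace κ →ₗᵢ[ℂ] Lp ℂ 2 ν) (δ : UnitaryDual D.K → sections Vγ κ),
      IsConvenient Vγ l lam ξ ∧ (∀ χ, IsIsotypicPart (delta T) χ (δ χ)) ∧
      ∀ f, IsKFinite γ f → σ f = ∑ᶠ χ, sigmaLim ξ (psi T) (δ χ) f}

/-! ### The projection `P_T` and the algebra of sections of `Γ\G ×_M End(V_κ̃)` -/

section Projection

variable [CompleteSpace Vκ] [CompleteSpace Vγ]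

/-- `T ∈ V_κ ⊗ V_γ` as an operator from the dual of `V_κ` to `V_γ`. -/
noncomputable def tensorHom (T : Vκ ⊗[ℂ] Vγ) : DualSpace Vκ →L[ℂ] Vγ :=
  LinearMap.toContinuousLinearMap
    { toFun := fun ℓ => TensorProduct.lid ℂ Vγ
        (LinearMap.rTensor Vγ ((show StrongDual ℂ Vκ from ℓ : StrongDual ℂ Vκ) : Vκ →ₗ[ℂ] ℂ) T)
      map_add' := fun a b => by
        rw [← map_add, ← LinearMap.add_apply, ← LinearMap.rTensor_add]; rfl
      map_smul' := fun c a => by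
        rw [← map_smul, ← LinearMap.smul_apply, ← LinearMap.rTensor_smul]; rfl }

/-- `dim(V_κ) T T* ∈ End(V_γ)`. -/
noncomputable def projEnd (T : Vκ ⊗[ℂ] Vγ) : Vγ →L[ℂ] Vγ :=
  (Module.finrank ℂ Vκ : ℂ) • (tensorHom T).comp (ContinuousLinearMap.adjoint (tensorHom T))

theorem projEnd_star (T : Vκ ⊗[ℂ] Vγ) : star (projEnd T) = projEnd T := by
  rw [projEnd, star_smul, ContinuousLinearMap.star_eq_adjoint, ContinuousLinearMap.adjoint_comp,
    ContinuousLinearMap.adjoint_adjoint]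
  simp

variable (Γ) in
/-- `P_T = 1 ⊗ dim(V_κ) T T* ∈ A_γ`. -/
noncomputable def proj (T : Vκ ⊗[ℂ] Vγ) : C(RightCosets Γ, Vγ →L[ℂ] Vγ) :=
  ContinuousMap.const _ (projEnd T)

theorem proj_star (T : Vκ ⊗[ℂ] Vγ) : star (proj Γ T) = proj Γ T := by
  ext1 x
  exact projEnd_star T

variable (Γ) in
/-- The algebra `P_T A_γ^M P_T`. -/
noncomputable def corner (T : invariants κ γ) :
    NonUnitalStarSubalgebra ℂ C(RightCosets Γ, Vγ →L[ℂ] Vγ) where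
  carrier := {f | (∀ m : D.M, act ((m : D.K) : G) (γ.toHom (m : D.K)) f = f) ∧
    proj Γ (T : Vκ ⊗[ℂ] Vγ) * f = f ∧ f * proj Γ (T : Vκ ⊗[ℂ] Vγ) = f}
  add_mem' {a b} ha hb :=
    ⟨fun m => by rw [act_add, ha.1 m, hb.1 m], by rw [mul_add, ha.2.1, hb.2.1],
      by rw [add_mul, ha.2.2, hb.2.2]⟩
  zero_mem' := ⟨fun m => act_zero _ _, mul_zero _, zero_mul _⟩
  mul_mem' {a b} ha hb :=
    ⟨fun m => by rw [act_mul, ha.1 m, hb.1 m], by rw [← mul_assoc, ha.2.1],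
      by rw [mul_assoc, hb.2.2]⟩
  smul_mem' c a ha :=
    ⟨fun m => by rw [act_smul, ha.1 m], by rw [mul_smul_comm, ha.2.1],
      by rw [smul_mul_assoc, ha.2.2]⟩
  star_mem' {a} ha :=
    ⟨fun m => by rw [act_star, ha.1 m],
      (congrArg (· * star a) (proj_star (Γ := Γ) (T : Vκ ⊗[ℂ] Vγ)).symm).trans
        ((star_mul a (proj Γ (T : Vκ ⊗[ℂ] Vγ))).symm.trans (congrArg star ha.2.2)),
      (congrArg (star a * ·) (proj_star (Γ := Γ) (T : Vκ ⊗[ℂ] Vγ)).symm).trans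
        ((star_mul (proj Γ (T : Vκ ⊗[ℂ] Vγ)) a).symm.trans (congrArg star ha.2.1))⟩

variable (Γ κ) in
/-- `C(Γ\G ×_M End(V_κ̃))`, the algebra of continuous sections, as the algebra of `M`-invariants
in `C(Γ\G) ⊗ End(V_κ̃)`, where `κ̃` is the dual of `κ`. -/
noncomputable def bundleSections :
    StarSubalgebra ℂ C(RightCosets Γ, DualSpace Vκ →L[ℂ] DualSpace Vκ) where
  carrier := {f | ∀ m : D.M, act ((m : D.K) : G) (κ.dual m) f = f}
  add_mem' {a b} ha hb m := by rw [act_add, ha m, hb m]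
  mul_mem' {a b} ha hb m := by rw [act_mul, ha m, hb m]
  algebraMap_mem' c m := by
    rw [Algebra.algebraMap_eq_smul_one, act_smul, act_one]
  star_mem' {a} ha m := by rw [act_star, ha m]

section Shortcuts

/-! Instances which are found by unification only slowly. -/

noncomputable instance (T : invariants κ γ) : NonUnitalRing (corner Γ T) :=
  (corner Γ T).toNonUnitalRing

noncomputable instance (T : invariants κ γ) : AddZeroClass (corner Γ T) :=
  (corner Γ T).toNonUnitalRing.toAddZeroClass

noncomputable instance (T : invariants κ γ) : Add (corner Γ T) :=
  (corner Γ T).toNonUnitalRing.toNonUnitalNonAssocSemiring.toDistrib.toAdd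

noncomputable instance (T : invariants κ γ) : Mul (corner Γ T) :=
  (corner Γ T).toNonUnitalRing.toNonUnitalNonAssocSemiring.toDistrib.toMul

noncomputable instance : Semiring (bundleSections κ Γ) :=
  SubsemiringClass.toSemiring (bundleSections κ Γ)

noncomputable instance : Add (bundleSections κ Γ) := instDistribOfSemiring.toAdd

noncomputable instance : Mul (bundleSections κ Γ) := instDistribOfSemiring.toMul

noncomputable instance : StarRing (bundleSections κ Γ) := (bundleSections κ Γ).starRing

noncomputable instance : Algebra ℂ (bundleSections κ Γ) := (bundleSections κ Γ).algebra

end Shortcuts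

variable (γ) in
/-- The projection `f ↦ ∫_M m f dm` of `A_γ` onto `A_γ^M`. -/
noncomputable def averageM [T2Space G] [CompactSpace (RightCosets Γ)]
    (f : C(RightCosets Γ, Vγ →L[ℂ] Vγ)) : C(RightCosets Γ, Vγ →L[ℂ] Vγ) :=
  ∫ m : D.M, act ((m : D.K) : G) (γ.toHom (m : D.K)) f ∂D.haarM

end Projection

end Principal

end RepLift

/-!
The proof compares the values of a lift `σ ∈ V(l, κ, γ, T)` first on `K`-finite elements of `A_γ`,
where `σ` is given by the functionals `σ_{ψ_T, δ_{T,μ}}`, and then on all of `A_γ` by density.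

*Operators.* `T` is an `M`-equivariant operator from the dual of `V_κ` to `V_γ`. By Schur's lemma
`dim(V_κ) T* T'` is the scalar `⟨T, T'⟩` for `T, T' ∈ [V_κ ⊗ V_γ]^M` (`adjoint_tensorHom_tensorHom`;
the scalar is found by taking traces, `sum_inner_tensorHom`). With `T' = T` this makes `P_T` a
projection with `(1 ⊗ P_T) T = T`, and makes `f ↦ dim(V_κ) T* f T` and `h ↦ dim(V_κ) T h T*`
mutually inverse between `P_T A_γ^M P_T` and the algebra of sections (`cornerEquiv`).

*Invariance.* The isotypic parts `δ_{T,μ}` are determined by `δ_T`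
(`IsIsotypicPart.eq_of_isIsotypic`), so they inherit its symmetries: they are fixed by `M` and by
`1 ⊗ P_T`. The section `ψ_T` is fixed by `K`. As `σ^ξ_{kφ, kψ}(kf) = σ^ξ_{φ,ψ}(f)`
(`IsEmbedding.sigma_act`) and `σ^ξ_{φ,ψ}(f P_T) = σ^ξ_{φ,(1 ⊗ P_T)ψ}(f)` (`sigma_mul_proj`), the
terms of the sum for `σ(mf)` and for `σ(f P_T)` are those of the sum for `σ(f)`, and no convergence
is needed to conclude. The identity `σ(P_T f) = σ(f)` follows because states are hermitian.

*Density.* That `K`-finite elements are dense in `A_γ` is the Peter–Weyl theorem for Banach space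
representations (`dense_finiteVectors`). Convolution with a symmetric bump function `η` is a compact
self-adjoint operator on `L²(K)` commuting with left translations. Its eigenspaces for nonzero
eigenvalues are finite-dimensional and invariant, hence so are their images under `φ ↦ π(φ) f`. By
the spectral theorem `π(η * η) f` is a limit of vectors from such images, and it is close to `f`.

*Conclusion.* The state `σ⁰` is `σ ∘ Φ⁻¹`, and `σ` does not change under averaging over `M`. For
linearly independent unit vectors `T`, `T'` a common lift would give
`1 = σ(P_{T'}) = σ(P_T P_{T'} P_T) = |⟨T, T'⟩|²`, against the strict Cauchy–Schwarz inequality.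
-/

set_option linter.unusedSectionVars false

namespace RepLift

/-! ### The Peter–Weyl theorem -/

section PeterWeyl

/-- The vectors of a representation which lie in a finite-dimensional invariant subspace. -/
noncomputable def finiteVectors {K B : Type*} [Group K] [NormedAddCommGroup B] [NormedSpace ℂ B]
    (π : K →* (B →L[ℂ] B)) : Submodule ℂ B where
  carrier := {f | ∃ W : Submodule ℂ B, FiniteDimensional ℂ W ∧ (∀ k, ∀ w ∈ W, π k w ∈ W) ∧ f ∈ W}
  add_mem' := by
    rintro a b ⟨W, hW, hWk, ha⟩ ⟨W', hW', hWk', hb⟩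
    refine ⟨W ⊔ W', inferInstance, fun k w hw => ?_,
      add_mem (Submodule.mem_sup_left ha) (Submodule.mem_sup_right hb)⟩
    obtain ⟨x, hx, y, hy, rfl⟩ := Submodule.mem_sup.1 hw
    rw [map_add]
    exact add_mem (Submodule.mem_sup_left (hWk k x hx)) (Submodule.mem_sup_right (hWk' k y hy))
  zero_mem' := ⟨⊥, inferInstance, fun k w hw => by
    rw [Submodule.mem_bot] at hw ⊢; rw [hw, map_zero], Submodule.zero_mem _⟩
  smul_mem' := by
    rintro c a ⟨W, hW, hWk, ha⟩
    exact ⟨W, hW, hWk, W.smul_mem c ha⟩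

variable {K : Type*} [Group K] [TopologicalSpace K] [IsTopologicalGroup K] [CompactSpace K]
  [MeasurableSpace K] [BorelSpace K] (μ : Measure K) [IsFiniteMeasure μ]
  {B : Type*} [NormedAddCommGroup B] [NormedSpace ℂ B] [CompleteSpace B]

/-- The operator `φ ↦ ∫ φ(k) F(k) dk` from `L²(K)` to `B`, for `F` in `L²(K, B)`. -/
noncomputable def smear (F : Lp B 2 μ) : Lp ℂ 2 μ →L[ℂ] B :=
  (ContinuousLinearMap.lsmul ℂ ℂ (E := B)).flip.lpPairing μ 2 2 F

theorem smear_apply (F : Lp B 2 μ) (φ : Lp ℂ 2 μ) : smear μ F φ = ∫ k, φ k • F k ∂μ :=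
  ContinuousLinearMap.lpPairing_eq_integral _ _ _

theorem smear_add (F F' : Lp B 2 μ) : smear μ (F + F') = smear μ F + smear μ F' :=
  map_add _ _ _

/-- Simple functions `F` give operators of finite rank, simple functions are dense in `L²`, and
limits of compact operators are compact. -/
theorem isCompactOperator_smear (F : Lp B 2 μ) : IsCompactOperator (smear μ F) := by
  induction F using Lp.induction (by norm_num : (2 : ENNReal) ≠ ⊤) with
  | indicatorConst c hs hμs =>
    rename_i s
    set F : Lp B 2 μ :=
      ((Lp.simpleFunc.indicatorConst 2 hs hμs.ne c : Lp.simpleFunc B 2 μ) : Lp B 2 μ)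
    set G : Lp ℂ 2 μ := indicatorConstLp 2 hs hμs.ne 1
    have h : smear μ F = (ContinuousLinearMap.toSpanSingleton ℂ c).comp (smear μ G) := by
      ext φ
      rw [ContinuousLinearMap.comp_apply, smear_apply, smear_apply,
        ContinuousLinearMap.toSpanSingleton_apply, ← integral_smul_const]
      refine integral_congr_ae ?_
      have hF : F = indicatorConstLp 2 hs hμs.ne c := Lp.simpleFunc.coe_indicatorConst hs hμs.ne c
      rw [hF]
      filter_upwards [indicatorConstLp_coeFn (p := 2) (hs := hs) (hμs := hμs.ne) (c := c),
        indicatorConstLp_coeFn (p := 2) (hs := hs) (hμs := hμs.ne) (c := (1 : ℂ))] with k h1 h2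
      rw [h1, h2]
      by_cases hk : k ∈ s <;> simp [hk]
    rw [h]
    have hG : IsCompactOperator (smear μ G) := isCompactOperator_of_locallyCompactSpace_dom _
    exact hG.clm_comp (ContinuousLinearMap.toSpanSingleton ℂ c)
  | add hf hg _ h1 h2 => rw [smear_add]; exact h1.add h2
  | isClosed =>
    exact isClosed_setOfPred_isCompactOperator.preimage
      ((ContinuousLinearMap.lsmul ℂ ℂ (E := B)).flip.lpPairing μ 2 2).continuous

variable [SecondCountableTopology K]

theorem smear_toLp (F : C(K, B)) (φ : Lp ℂ 2 μ) :
    smear μ (F.toLp 2 μ ℂ) φ = ∫ k, φ k • F k ∂μ := by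
  rw [smear_apply]
  refine integral_congr_ae ?_
  filter_upwards [ContinuousMap.coeFn_toLp (p := 2) (𝕜 := ℂ) μ F] with k hk
  rw [hk]

theorem integrable_smul_continuousMap (F : C(K, B)) (φ : Lp ℂ 2 μ) :
    Integrable (fun k => φ k • F k) μ :=
  ((Lp.memLp φ).integrable (by norm_num)).smul_bdd ‖F‖
    F.continuous.aestronglyMeasurable (.of_forall F.norm_coe_le_norm)

variable [μ.IsMulLeftInvariant]

/-- Left translation on `L²(K)`. -/
noncomputable def translateLp (g : K) : Lp ℂ 2 μ →ₗᵢ[ℂ] Lp ℂ 2 μ :=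
  Lp.compMeasurePreservingₗᵢ ℂ (g⁻¹ * ·) (measurePreserving_mul_left μ g⁻¹)

theorem translateLp_coeFn (g : K) (φ : Lp ℂ 2 μ) :
    translateLp μ g φ =ᵐ[μ] fun k => φ (g⁻¹ * k) :=
  Lp.coeFn_compMeasurePreserving φ (measurePreserving_mul_left μ g⁻¹)

/-- The orbit map of a vector of a strongly continuous representation. -/
def orbitMap {π : K →* (B →L[ℂ] B)} (hπ : ∀ f, Continuous fun k => π k f) (f : B) : C(K, B) :=
  ⟨fun k => π k f, hπ f⟩

/-- The map `φ ↦ π(φ) f = ∫ φ(k) π(k) f dk` on `L²(K)`, for a fixed vector `f`. -/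
noncomputable def integrated {π : K →* (B →L[ℂ] B)} (hπ : ∀ f, Continuous fun k => π k f) (f : B) :
    Lp ℂ 2 μ →L[ℂ] B :=
  smear μ ((orbitMap hπ f).toLp 2 μ ℂ)

section Integrated

variable {π : K →* (B →L[ℂ] B)} (hπ : ∀ f, Continuous fun k => π k f) (f : B)

theorem integrated_apply (φ : Lp ℂ 2 μ) : integrated μ hπ f φ = ∫ k, φ k • π k f ∂μ :=
  smear_toLp μ _ φ

theorem map_integrated (g : K) (φ : Lp ℂ 2 μ) :
    π g (integrated μ hπ f φ) = integrated μ hπ f (translateLp μ g φ) := by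
  rw [integrated_apply, integrated_apply]
  have hint : Integrable (fun k => φ k • π k f) μ :=
    integrable_smul_continuousMap μ (orbitMap hπ f) φ
  rw [← ContinuousLinearMap.integral_comp_comm _ hint]
  have h : ∫ k, translateLp μ g φ k • π k f ∂μ = ∫ k, φ (g⁻¹ * k) • π k f ∂μ :=
    integral_congr_ae (by
      filter_upwards [translateLp_coeFn μ g φ] with k hk
      rw [hk])
  rw [h, ← integral_mul_left_eq_self (fun k => φ (g⁻¹ * k) • π k f) g]
  refine integral_congr_ae (.of_forall fun k => ?_)
  simp only [inv_mul_cancel_left, map_mul, map_smul]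
  rfl

end Integrated

/-- The left regular representation on `C(K)`. -/
noncomputable def leftRegular (K : Type*) [Group K] [TopologicalSpace K] [IsTopologicalGroup K]
    [CompactSpace K] : K →* (C(K, ℂ) →L[ℂ] C(K, ℂ)) where
  toFun g :=
    { toFun := fun φ => φ.comp ⟨fun k => g⁻¹ * k, continuous_const_mul g⁻¹⟩
      map_add' := fun _ _ => rfl
      map_smul' := fun _ _ => rfl
      cont := ContinuousMap.continuous_precomp _ }
  map_one' := by ext φ k; exact congrArg φ (by simp)
  map_mul' a b := by ext φ k; exact congrArg φ (by simp [mul_assoc])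

theorem leftRegular_apply (g : K) (φ : C(K, ℂ)) (k : K) : leftRegular K g φ k = φ (g⁻¹ * k) := rfl

theorem continuous_leftRegular (φ : C(K, ℂ)) : Continuous fun g => leftRegular K g φ :=
  ContinuousMap.continuous_of_continuous_uncurry _
    (φ.continuous.comp (continuous_fst.inv.mul continuous_snd))

theorem translateLp_toLp (g : K) (φ : C(K, ℂ)) :
    translateLp μ g (φ.toLp 2 μ ℂ) = (leftRegular K g φ).toLp 2 μ ℂ := by
  refine Lp.ext ?_
  filter_upwards [translateLp_coeFn μ g (φ.toLp 2 μ ℂ),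
    ContinuousMap.coeFn_toLp (p := 2) (𝕜 := ℂ) μ (leftRegular K g φ),
    (measurePreserving_mul_left μ g⁻¹).quasiMeasurePreserving.ae
      (ContinuousMap.coeFn_toLp (p := 2) (𝕜 := ℂ) μ φ)] with k h1 h2 h3
  rw [h1, h2, h3, leftRegular_apply]

/-- The convolution operator `φ ↦ φ * η`, `(φ * η)(k) = ∫ φ(h) η(h⁻¹k) dh`, on `L²(K)`. -/
noncomputable def convolveRight (η : C(K, ℂ)) : Lp ℂ 2 μ →L[ℂ] Lp ℂ 2 μ :=
  (ContinuousMap.toLp 2 μ ℂ).comp (integrated μ continuous_leftRegular η)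

theorem convolveRight_coeFn (η : C(K, ℂ)) (φ : Lp ℂ 2 μ) :
    convolveRight μ η φ =ᵐ[μ] fun k => ∫ h, φ h * η (h⁻¹ * k) ∂μ := by
  filter_upwards [ContinuousMap.coeFn_toLp (p := 2) (𝕜 := ℂ) μ
    (integrated μ continuous_leftRegular η φ)] with k hk
  refine hk.trans ?_
  rw [integrated_apply]
  have hint : Integrable (fun k => φ k • leftRegular K k η) μ :=
    integrable_smul_continuousMap μ (orbitMap continuous_leftRegular η) φ
  exact (ContinuousLinearMap.integral_comp_comm (ContinuousMap.evalCLM ℂ k) hint).symm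

theorem isCompactOperator_convolveRight (η : C(K, ℂ)) : IsCompactOperator (convolveRight μ η) :=
  (isCompactOperator_smear μ
    ((orbitMap continuous_leftRegular η).toLp 2 μ ℂ)).clm_comp (ContinuousMap.toLp 2 μ ℂ)

theorem convolveRight_translateLp (η : C(K, ℂ)) (g : K) (φ : Lp ℂ 2 μ) :
    convolveRight μ η (translateLp μ g φ) = translateLp μ g (convolveRight μ η φ) := by
  simp only [convolveRight, ContinuousLinearMap.comp_apply]
  rw [← map_integrated]
  exact (translateLp_toLp μ g _).symm

theorem isSymmetric_convolveRight (η : C(K, ℂ)) (hη : ∀ k, η k⁻¹ = starRingEnd ℂ (η k)) :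
    (convolveRight μ η).IsSymmetric := by
  intro ψ φ
  have hφ : Integrable φ μ := (Lp.memLp φ).integrable (by norm_num)
  have hψ : Integrable ψ μ := (Lp.memLp ψ).integrable (by norm_num)
  have h1 : inner ℂ (convolveRight μ η ψ) φ =
      ∫ x, ∫ h, φ x * starRingEnd ℂ (ψ h) * starRingEnd ℂ (η (h⁻¹ * x)) ∂μ ∂μ := by
    rw [L2.inner_def]
    refine integral_congr_ae ?_
    filter_upwards [convolveRight_coeFn μ η ψ] with x hx
    rw [hx, RCLike.inner_apply, ← integral_conj, ← integral_const_mul]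
    simp only [map_mul, mul_assoc]
  have h2 : inner ℂ ψ (convolveRight μ η φ) =
      ∫ x, ∫ h, φ h * starRingEnd ℂ (ψ x) * starRingEnd ℂ (η (x⁻¹ * h)) ∂μ ∂μ := by
    rw [L2.inner_def]
    refine integral_congr_ae ?_
    filter_upwards [convolveRight_coeFn μ η φ] with x hx
    rw [hx, RCLike.inner_apply, ← integral_mul_const]
    refine integral_congr_ae (.of_forall fun h => ?_)
    simp only
    rw [← hη, mul_inv_rev, inv_inv]
    ring
  change inner ℂ (convolveRight μ η ψ) φ = inner ℂ ψ (convolveRight μ η φ)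
  rw [h1, h2]
  refine integral_integral_swap ?_
  have hψ' : Integrable (fun h => starRingEnd ℂ (ψ h)) μ :=
    (integrable_norm_iff (Complex.continuous_conj.comp_aestronglyMeasurable hψ.1)).1
      (by simpa using hψ.norm)
  refine (hφ.mul_prod hψ').mul_bdd (c := ‖η‖) ?_ (.of_forall fun x => ?_)
  · exact (Complex.continuous_conj.comp (η.continuous.comp
      (continuous_snd.inv.mul continuous_fst))).aestronglyMeasurable
  · simpa using η.norm_coe_le_norm _

section Density

variable {π : K →* (B →L[ℂ] B)} (hπ : ∀ f, Continuous fun k => π k f) (f : B)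

/-- For an eigenfunction `φ` of a convolution operator with nonzero eigenvalue the vector `π(φ) f`
lies in the image of the eigenspace, which is finite-dimensional and invariant. -/
theorem integrated_mem_finiteVectors (η : C(K, ℂ)) {c : ℂ} (hc : c ≠ 0) {φ : Lp ℂ 2 μ}
    (hφ : φ ∈ Module.End.eigenspace (convolveRight μ η).toLinearMap c) :
    integrated μ hπ f φ ∈ finiteVectors π := by
  have := ContinuousLinearMap.finite_dimensional_eigenspace
    (isCompactOperator_convolveRight μ η) c hc
  refine ⟨(Module.End.eigenspace (convolveRight μ η).toLinearMap c).map
    (integrated μ hπ f).toLinearMap, inferInstance, ?_, Submodule.mem_map_of_mem hφ⟩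
  rintro k _ ⟨ψ, hψ, rfl⟩
  refine ⟨translateLp μ k ψ, ?_, (map_integrated μ hπ f k ψ).symm⟩
  have hψ' : convolveRight μ η ψ = c • ψ := Module.End.mem_eigenspace_iff.1 hψ
  refine Module.End.mem_eigenspace_iff.2 ?_
  change convolveRight μ η (translateLp μ k ψ) = _
  rw [convolveRight_translateLp, hψ', map_smul]

theorem integrated_convolveRight_mem_closure (η : C(K, ℂ))
    (hη : ∀ k, η k⁻¹ = starRingEnd ℂ (η k)) (φ : Lp ℂ 2 μ) :
    integrated μ hπ f (convolveRight μ η φ) ∈ (finiteVectors π).topologicalClosure := by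
  set R := convolveRight μ η
  have hdense : (⨆ c, Module.End.eigenspace (R : Module.End ℂ (Lp ℂ 2 μ)) c).topologicalClosure
      = ⊤ := by
    rw [Submodule.topologicalClosure_eq_top_iff]
    exact ContinuousLinearMap.orthogonalComplement_iSup_eigenspaces_eq_bot
      (isCompactOperator_convolveRight μ η) (isSymmetric_convolveRight μ η hη)
  have hle : (⨆ c, Module.End.eigenspace (R : Module.End ℂ (Lp ℂ 2 μ)) c).topologicalClosure ≤
      (finiteVectors π).topologicalClosure.comap
        ((integrated μ hπ f).comp R).toLinearMap := by
    refine Submodule.topologicalClosure_minimal _ (iSup_le fun c ψ hψ => ?_)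
      ((finiteVectors π).isClosed_topologicalClosure.preimage
        ((integrated μ hπ f).comp R).continuous)
    have hψ' : R ψ = c • ψ := Module.End.mem_eigenspace_iff.1 hψ
    change integrated μ hπ f (R ψ) ∈ (finiteVectors π).topologicalClosure
    rw [hψ', map_smul]
    by_cases hc : c = 0
    -- the kernel of `R`, which may be infinite-dimensional, does not contribute
    · rw [hc, zero_smul]; exact zero_mem _
    · exact Submodule.smul_mem _ _ (Submodule.le_topologicalClosure _
        (integrated_mem_finiteVectors μ hπ f η hc hψ))
  exact hle (hdense ▸ Submodule.mem_top : φ ∈ _)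

/-- `π(φ * η) f = π(φ) π(η) f`. -/
theorem integrated_convolveRight (η : C(K, ℂ)) (φ : Lp ℂ 2 μ) :
    integrated μ hπ f (convolveRight μ η φ) =
      integrated μ hπ (integrated μ hπ f (η.toLp 2 μ ℂ)) φ := by
  have hint : Integrable (fun k => φ k • leftRegular K k η) μ :=
    integrable_smul_continuousMap μ (orbitMap continuous_leftRegular η) φ
  rw [convolveRight, ContinuousLinearMap.comp_apply, integrated_apply μ continuous_leftRegular,
    ← ContinuousLinearMap.integral_comp_comm _ hint,
    ← ContinuousLinearMap.integral_comp_comm _ (ContinuousLinearMap.integrable_comp _ hint),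
    integrated_apply]
  refine integral_congr_ae (.of_forall fun k => ?_)
  simp only [map_smul]
  rw [map_integrated, translateLp_toLp]

end Density

theorem exists_symmetric_bump [T2Space K] [μ.IsOpenPosMeasure] {U : Set K} (hU : U ∈ 𝓝 (1 : K)) :
    ∃ ρ : C(K, ℝ), (∀ k, 0 ≤ ρ k) ∧ (∀ k, ρ k⁻¹ = ρ k) ∧ (∀ k, k ∉ U → ρ k = 0) ∧
      ∫ k, ρ k ∂μ = 1 := by
  obtain ⟨V, hVU, hVo, hV1⟩ := mem_nhds_iff.1 hU
  obtain ⟨g, hg0, hg1, hgI⟩ := exists_continuous_zero_one_of_isClosed hVo.isClosed_compl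
    (isClosed_singleton (x := (1 : K))) (by simpa using hV1)
  set r : C(K, ℝ) := g * g.comp ⟨fun k => k⁻¹, continuous_inv⟩ with hr
  have hrk : ∀ k, r k = g k * g k⁻¹ := fun _ => rfl
  have hr0 : ∀ k, 0 ≤ r k := fun k => mul_nonneg (hgI k).1 (hgI k⁻¹).1
  have hpos : 0 < ∫ k, r k ∂μ := by
    refine r.continuous.integral_pos_of_hasCompactSupport_nonneg_nonzero
      (HasCompactSupport.of_compactSpace _) hr0 (x := 1) ?_
    rw [hrk, inv_one, hg1 rfl]; norm_num
  refine ⟨(∫ k, r k ∂μ)⁻¹ • r, fun k => mul_nonneg (inv_nonneg.2 hpos.le) (hr0 k), fun k => ?_,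
    fun k hk => ?_, ?_⟩
  · simp only [ContinuousMap.smul_apply, hrk, inv_inv, mul_comm]
  · have : g k = 0 := hg0 fun h => hk (hVU h)
    simp [hrk, this]
  · simp only [ContinuousMap.smul_apply, smul_eq_mul]
    rw [integral_const_mul, inv_mul_cancel₀ hpos.ne']

/-- **Peter–Weyl theorem**: in a strongly continuous representation of a compact group by
contractions of a Banach space the vectors contained in finite-dimensional invariant subspaces are
dense. -/
theorem dense_finiteVectors [T2Space K] [μ.IsOpenPosMeasure] {π : K →* (B →L[ℂ] B)}
    (hπ : ∀ f, Continuous fun k => π k f) (hπ_norm : ∀ k f, ‖π k f‖ ≤ ‖f‖) :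
    Dense (finiteVectors π : Set B) := by
  intro f
  rw [← Submodule.topologicalClosure_coe, SetLike.mem_coe, ← SetLike.mem_coe,
    ← (finiteVectors π).isClosed_topologicalClosure.closure_eq]
  refine Metric.mem_closure_iff.2 fun ε hε => ?_
  have hU : {k : K | ‖π k f - f‖ < ε / 4} ∈ 𝓝 (1 : K) := by
    refine IsOpen.mem_nhds (isOpen_lt (((hπ f).sub continuous_const).norm) continuous_const) ?_
    simp only [Set.mem_ofPred_eq, map_one, one_apply_eq_self, sub_self, norm_zero]
    positivity
  obtain ⟨ρ, hρ0, hρs, hρU, hρ1⟩ := exists_symmetric_bump μ hU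
  have hρi : Integrable ρ μ := ρ.continuous.integrable_of_hasCompactSupport
    (HasCompactSupport.of_compactSpace _)
  set η : C(K, ℂ) := ⟨fun k => (ρ k : ℂ), Complex.continuous_ofReal.comp ρ.continuous⟩
  have happ : ∀ g, integrated μ hπ g (η.toLp 2 μ ℂ) = ∫ k, ρ k • π k g ∂μ := by
    intro g
    rw [integrated_apply]
    refine integral_congr_ae ?_
    filter_upwards [ContinuousMap.coeFn_toLp (p := 2) (𝕜 := ℂ) μ η] with k hk
    rw [hk]
    exact Complex.coe_smul (ρ k) (π k g)
  have hint : ∀ g, Integrable (fun k => ρ k • π k g) μ := fun g =>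
    (ρ.continuous.smul (hπ g)).integrable_of_hasCompactSupport
      (HasCompactSupport.of_compactSpace _)
  have hbound : ∀ g, ‖integrated μ hπ g (η.toLp 2 μ ℂ)‖ ≤ ‖g‖ := by
    intro g
    rw [happ]
    refine (norm_integral_le_of_norm_le (hρi.mul_const ‖g‖) (.of_forall fun k => ?_)).trans ?_
    · rw [norm_smul, Real.norm_of_nonneg (hρ0 k)]
      exact mul_le_mul_of_nonneg_left (hπ_norm k g) (hρ0 k)
    · rw [integral_mul_const, hρ1, one_mul]
  have hclose : ‖integrated μ hπ f (η.toLp 2 μ ℂ) - f‖ ≤ ε / 4 := by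
    have h1 : integrated μ hπ f (η.toLp 2 μ ℂ) - f = ∫ k, ρ k • (π k f - f) ∂μ := by
      simp only [smul_sub]
      rw [integral_sub (hint f) (hρi.smul_const f), integral_smul_const, hρ1, one_smul, happ]
    rw [h1]
    refine (norm_integral_le_of_norm_le (hρi.mul_const (ε / 4)) (.of_forall fun k => ?_)).trans ?_
    · rw [norm_smul, Real.norm_of_nonneg (hρ0 k)]
      by_cases hk : ‖π k f - f‖ < ε / 4
      · exact mul_le_mul_of_nonneg_left hk.le (hρ0 k)
      · rw [hρU k hk]; simp
    · rw [integral_mul_const, hρ1, one_mul]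
  -- `π(η * η) f` approximates `f`, since `π(η) f` does and `π(η)` is a contraction
  refine ⟨_, integrated_convolveRight_mem_closure μ hπ f η (fun k => ?_) (η.toLp 2 μ ℂ), ?_⟩
  · change (ρ k⁻¹ : ℂ) = starRingEnd ℂ (ρ k : ℂ)
    rw [hρs, Complex.conj_ofReal]
  rw [integrated_convolveRight, dist_comm, dist_eq_norm]
  set g := integrated μ hπ f (η.toLp 2 μ ℂ)
  have hsub : integrated μ hπ g (η.toLp 2 μ ℂ) - f =
      integrated μ hπ (g - f) (η.toLp 2 μ ℂ) + (g - f) := by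
    have : integrated μ hπ (g - f) (η.toLp 2 μ ℂ) = integrated μ hπ g (η.toLp 2 μ ℂ) - g := by
      rw [happ, happ]
      simp only [map_sub, smul_sub]
      rw [integral_sub (hint g) (hint f), ← happ f]
    rw [this]; abel
  rw [hsub]
  calc _ ≤ ‖g - f‖ + ‖g - f‖ := (norm_add_le _ _).trans (add_le_add_left (hbound _) _)
    _ < ε := by linarith

end PeterWeyl

/-! ### The action of `K` on `A_γ` and its finite elements -/

section ActionMaps

variable {G : Type*} [Group G] [TopologicalSpace G] [IsTopologicalGroup G] {Γ : Subgroup G}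
  {V : Type*} [NormedAddCommGroup V] [InnerProductSpace ℂ V]

theorem mulRight_mulRight (g h : G) (x : RightCosets Γ) :
    (x.mulRight g).mulRight h = x.mulRight (g * h) := by
  induction x using Quotient.inductionOn with
  | h a => exact congrArg (Quotient.mk _) (mul_assoc a g h)

theorem mulRight_one (x : RightCosets Γ) : x.mulRight 1 = x := by
  induction x using Quotient.inductionOn with
  | h a => exact congrArg (Quotient.mk _) (mul_one a)

/-- Joint continuity: `G × G → G × Γ\G` is a quotient map because `G → Γ\G` is open. -/
theorem continuous_mulRight_uncurry :
    Continuous fun p : G × RightCosets Γ => p.2.mulRight p.1 := by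
  have hopen : IsOpenMap (Quotient.mk (QuotientGroup.rightRel Γ)) :=
    isOpenMap_quotient_mk'_mul (Γ := Γ) (T := G)
  have hq : IsOpenQuotientMap (Quotient.mk (QuotientGroup.rightRel Γ)) :=
    ⟨Quotient.mk_surjective, continuous_quotient_mk', hopen⟩
  have hq' := (IsOpenQuotientMap.id (X := G)).prodMap hq
  refine hq'.isQuotientMap.continuous_iff.2 ?_
  exact continuous_quotient_mk'.comp (continuous_snd.mul continuous_fst)

theorem act_act (g h : G) (u v : V ≃ₗᵢ[ℂ] V) (f : C(RightCosets Γ, V →L[ℂ] V)) :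
    act g u (act h v f) = act (g * h) (v.trans u) f := by
  ext x w
  simp only [act_apply, mulRight_mulRight]
  rfl

theorem act_one_refl (f : C(RightCosets Γ, V →L[ℂ] V)) :
    act 1 (LinearIsometryEquiv.refl ℂ V) f = f := by
  ext x w
  simp only [act_apply, mulRight_one]
  rfl

/-- The transformation `act g u` as a continuous linear map. -/
noncomputable def actL (g : G) (u : V ≃ₗᵢ[ℂ] V) :
    C(RightCosets Γ, V →L[ℂ] V) →L[ℂ] C(RightCosets Γ, V →L[ℂ] V) where
  toFun := act g u
  map_add' := act_add g u
  map_smul' c f := act_smul g u f c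
  cont := by
    have h1 := ContinuousMap.continuous_precomp (Z := V →L[ℂ] V)
      ⟨_, RightCosets.continuous_mulRight (Γ := Γ) g⟩
    have h2 : Continuous fun f : V →L[ℂ] V =>
        (u.toContinuousLinearEquiv.toContinuousLinearMap.comp f).comp
          u.symm.toContinuousLinearEquiv.toContinuousLinearMap :=
      (continuous_const.clm_comp continuous_id).clm_comp continuous_const
    exact (ContinuousMap.continuous_postcomp (X := RightCosets Γ) ⟨_, h2⟩).comp h1

theorem actL_apply (g : G) (u : V ≃ₗᵢ[ℂ] V) (f : C(RightCosets Γ, V →L[ℂ] V)) :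
    actL g u f = act g u f := rfl

theorem norm_act_le [CompactSpace (RightCosets Γ)] (g : G) (u : V ≃ₗᵢ[ℂ] V)
    (f : C(RightCosets Γ, V →L[ℂ] V)) : ‖act g u f‖ ≤ ‖f‖ := by
  refine (ContinuousMap.norm_le _ (norm_nonneg f)).2 fun x => ?_
  refine ContinuousLinearMap.opNorm_le_bound _ (norm_nonneg f) fun v => ?_
  rw [act_apply, u.norm_map]
  calc _ ≤ ‖f (x.mulRight g)‖ * ‖u.symm v‖ := ContinuousLinearMap.le_opNorm _ _
    _ ≤ ‖f‖ * ‖v‖ := by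
      rw [u.symm.norm_map]
      exact mul_le_mul_of_nonneg_right (f.norm_coe_le_norm _) (norm_nonneg _)

theorem continuous_act {H : Type*} [TopologicalSpace H] [FiniteDimensional ℂ V] {i : H → G}
    (hi : Continuous i) {u : H → V ≃ₗᵢ[ℂ] V} (hu : ∀ v, Continuous fun h => u h v)
    (hu' : ∀ v, Continuous fun h => (u h).symm v) (f : C(RightCosets Γ, V →L[ℂ] V)) :
    Continuous fun h => act (i h) (u h) f := by
  refine ContinuousMap.continuous_of_continuous_uncurry _ ?_
  have h1 : Continuous fun h => (u h).toContinuousLinearEquiv.toContinuousLinearMap :=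
    continuous_clm_apply.2 hu
  have h2 : Continuous fun h => (u h).symm.toContinuousLinearEquiv.toContinuousLinearMap :=
    continuous_clm_apply.2 hu'
  have h3 : Continuous fun p : H × RightCosets Γ => f (p.2.mulRight (i p.1)) :=
    f.continuous.comp
      (continuous_mulRight_uncurry.comp ((hi.comp continuous_fst).prodMk continuous_snd))
  exact ((h1.comp continuous_fst).clm_comp h3).clm_comp (h2.comp continuous_fst)

theorem UnitaryRep.symm_eq {H : Type*} [Group H] [TopologicalSpace H] (π : UnitaryRep H V) (h : H) :
    (π.toHom h).symm = π.toHom h⁻¹ := by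
  rw [map_inv]; rfl

theorem UnitaryRep.continuous_symm {H : Type*} [Group H] [TopologicalSpace H]
    [IsTopologicalGroup H] (π : UnitaryRep H V) (v : V) :
    Continuous fun h => (π.toHom h).symm v := by
  simp only [π.symm_eq]
  exact (π.continuous' v).comp continuous_inv

end ActionMaps

section KFinite

variable {E : Type*} [NormedAddCommGroup E] [NormedSpace ℝ E] [CompleteSpace E]
  {G : Type*} [TopologicalSpace G] [ChartedSpace E G] [Group G] [LieGroup 𝓘(ℝ, E) ∞ G]
  [IsTopologicalGroup G] [MeasurableSpace G] [BorelSpace G] [SecondCountableTopology G]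
  {D : IwasawaData E G} {Γ : Subgroup G}
  {Vγ : Type*} [NormedAddCommGroup Vγ] [InnerProductSpace ℂ Vγ] [FiniteDimensional ℂ Vγ]
  (γ : UnitaryRep D.K Vγ)

variable (Γ) in
/-- The representation of `K` on `A_γ`. -/
noncomputable def actRep : D.K →* (C(RightCosets Γ, Vγ →L[ℂ] Vγ) →L[ℂ]
    C(RightCosets Γ, Vγ →L[ℂ] Vγ)) where
  toFun k := actL (k : G) (γ.toHom k)
  map_one' := by
    refine ContinuousLinearMap.ext fun f => ?_
    rw [actL_apply, map_one]
    exact act_one_refl f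
  map_mul' a b := by
    refine ContinuousLinearMap.ext fun f => ?_
    rw [map_mul]
    exact (act_act (a : G) (b : G) (γ.toHom a) (γ.toHom b) f).symm

theorem continuous_actRep (f : C(RightCosets Γ, Vγ →L[ℂ] Vγ)) :
    Continuous fun k => actRep Γ γ k f :=
  continuous_act continuous_subtype_val γ.continuous' γ.continuous_symm f

theorem isKFinite_of_mem_finiteVectors [CompactSpace (RightCosets Γ)]
    {f : C(RightCosets Γ, Vγ →L[ℂ] Vγ)} (hf : f ∈ finiteVectors (actRep Γ γ)) : IsKFinite γ f := by
  obtain ⟨W, hW, hWk, hfW⟩ := hf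
  refine Submodule.finiteDimensional_of_le (S₂ := W) (Submodule.span_le.2 ?_)
  rintro _ ⟨k, rfl⟩
  exact hWk k f hfW

/-- The Peter–Weyl theorem for the action of `K` on the Banach space `A_γ`. -/
theorem dense_isKFinite [T2Space G] [CompactSpace (RightCosets Γ)] :
    Dense {f : C(RightCosets Γ, Vγ →L[ℂ] Vγ) | IsKFinite γ f} :=
  (dense_finiteVectors D.haarK (continuous_actRep γ) fun k f => norm_act_le (k : G) _ f).mono
    fun _ => isKFinite_of_mem_finiteVectors γ

theorem IsKFinite.mul {f f' : C(RightCosets Γ, Vγ →L[ℂ] Vγ)} (hf : IsKFinite γ f)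
    (hf' : IsKFinite γ f') : IsKFinite γ (f * f') := by
  unfold IsKFinite at *
  let m : C(RightCosets Γ, Vγ →L[ℂ] Vγ) →ₗ[ℂ] C(RightCosets Γ, Vγ →L[ℂ] Vγ) →ₗ[ℂ]
      C(RightCosets Γ, Vγ →L[ℂ] Vγ) :=
    LinearMap.mk₂ ℂ (fun a b => a * b)
      (fun a b c => ContinuousMap.ext fun x => add_mul (a x) (b x) (c x))
      (fun r a b => smul_mul_assoc r a b)
      (fun a b c => ContinuousMap.ext fun x => mul_add (a x) (b x) (c x))
      (fun r a b => mul_smul_comm r a b)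
  have hfg := (Module.Finite.iff_fg.1 hf).map₂ m (Module.Finite.iff_fg.1 hf')
  have := Module.Finite.iff_fg.2 hfg
  refine Submodule.finiteDimensional_of_le (Submodule.span_le.2 ?_) (S₂ := Submodule.map₂ m
    (Submodule.span ℂ (Set.range fun k : D.K => RepLift.act (k : G) (γ.toHom k) f))
    (Submodule.span ℂ (Set.range fun k : D.K => RepLift.act (k : G) (γ.toHom k) f')))
  rintro _ ⟨k, rfl⟩
  simp only [act_mul]
  exact Submodule.apply_mem_map₂ m (Submodule.subset_span ⟨k, rfl⟩) (Submodule.subset_span ⟨k, rfl⟩)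

theorem IsKFinite.act {f : C(RightCosets Γ, Vγ →L[ℂ] Vγ)} (hf : IsKFinite γ f) (h : D.K) :
    IsKFinite γ (RepLift.act (h : G) (γ.toHom h) f) := by
  unfold IsKFinite at *
  refine Submodule.finiteDimensional_of_le (Submodule.span_mono (t := Set.range fun k : D.K =>
    RepLift.act (k : G) (γ.toHom k) f) ?_)
  rintro _ ⟨k, rfl⟩
  exact ⟨k * h, congrArg (fun T => T f) (map_mul (actRep Γ γ) k h)⟩

/-- Conjugates of a constant function are constant, and `End(V_γ)` is finite-dimensional. -/
theorem isKFinite_const (S : Vγ →L[ℂ] Vγ) :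
    IsKFinite γ (ContinuousMap.const (RightCosets Γ) S) := by
  unfold IsKFinite
  let c : (Vγ →L[ℂ] Vγ) →ₗ[ℂ] C(RightCosets Γ, Vγ →L[ℂ] Vγ) :=
    { toFun := ContinuousMap.const _, map_add' := fun _ _ => rfl, map_smul' := fun _ _ => rfl }
  refine Submodule.finiteDimensional_of_le (S₂ := LinearMap.range c) (Submodule.span_le.2 ?_)
  rintro _ ⟨k, rfl⟩
  exact ⟨((γ.toHom k).toContinuousLinearEquiv.toContinuousLinearMap.comp S).comp
    (γ.toHom k).symm.toContinuousLinearEquiv.toContinuousLinearMap, rfl⟩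

end KFinite

/-! ### Schur's lemma and the operators `T` -/

section Schur

variable {H : Type*} [Group H] [TopologicalSpace H]
  {V : Type*} [NormedAddCommGroup V] [InnerProductSpace ℂ V] [FiniteDimensional ℂ V]

/-- **Schur's lemma**. -/
theorem UnitaryRep.IsIrreducible.exists_eq_smul {π : UnitaryRep H V} (hπ : π.IsIrreducible)
    (S : V →ₗ[ℂ] V) (hS : ∀ h v, S (π.toHom h v) = π.toHom h (S v)) :
    ∃ c : ℂ, ∀ v, S v = c • v := by
  have := hπ.1
  obtain ⟨c, hc⟩ := Module.End.exists_eigenvalue S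
  refine ⟨c, fun v => ?_⟩
  have hW := hπ.2 (Module.End.eigenspace S c) fun h w hw => by
    rw [Module.End.mem_eigenspace_iff] at hw ⊢
    rw [hS, hw, map_smul]
  have hW' := hW.resolve_left hc
  exact Module.End.mem_eigenspace_iff.1 (hW' ▸ Submodule.mem_top)

variable [CompleteSpace V]

theorem riesz_apply (v w : V) : (show StrongDual ℂ V from riesz v) w = inner ℂ v w := rfl

theorem riesz_add (v w : V) : riesz (v + w) = riesz v + riesz w :=
  map_add (InnerProductSpace.toDual ℂ V) v w

theorem riesz_smul (c : ℂ) (v : V) : riesz (c • v) = starRingEnd ℂ c • riesz v :=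
  (InnerProductSpace.toDual ℂ V).map_smulₛₗ c v

theorem riesz_symm_add (a b : DualSpace V) : riesz.symm (a + b) = riesz.symm a + riesz.symm b :=
  map_add (InnerProductSpace.toDual ℂ V).symm a b

theorem riesz_symm_smul (c : ℂ) (a : DualSpace V) :
    riesz.symm (c • a) = starRingEnd ℂ c • riesz.symm a :=
  (InnerProductSpace.toDual ℂ V).symm.map_smulₛₗ c a

theorem inner_riesz (v w : V) : inner ℂ (riesz v) (riesz w) = inner ℂ w v := by
  change inner ℂ (riesz.symm (riesz w)) (riesz.symm (riesz v)) = _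
  rw [Equiv.symm_apply_apply, Equiv.symm_apply_apply]

/-- The Riesz isomorphism identifies the dual representation with the conjugate of `π`. -/
theorem UnitaryRep.dual_riesz (π : UnitaryRep H V) (h : H) (v : V) :
    π.dual h (riesz v) = riesz (π.toHom h v) := by
  refine ContinuousLinearMap.ext fun w => ?_
  change inner ℂ v ((π.toHom h).symm w) = inner ℂ (π.toHom h v) w
  rw [← (π.toHom h).inner_map_map, LinearIsometryEquiv.apply_symm_apply]

theorem UnitaryRep.IsIrreducible.dual_exists_eq_smul {π : UnitaryRep H V} (hπ : π.IsIrreducible)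
    (S : DualSpace V →L[ℂ] DualSpace V) (hS : ∀ h ℓ, S (π.dual h ℓ) = π.dual h (S ℓ)) :
    ∃ c : ℂ, ∀ ℓ, S ℓ = c • ℓ := by
  -- conjugating with the antilinear Riesz isomorphism turns `S` into a linear operator on `V`
  obtain ⟨c, hc⟩ := hπ.exists_eq_smul
    { toFun := fun v => riesz.symm (S (riesz v))
      map_add' := fun v w => by rw [riesz_add, map_add, riesz_symm_add]
      map_smul' := fun c v => by
        rw [riesz_smul, map_smul, riesz_symm_smul, starRingEnd_self_apply]; rfl }
    fun h v => by
      change riesz.symm (S (riesz (π.toHom h v))) = π.toHom h (riesz.symm (S (riesz v)))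
      rw [← π.dual_riesz, hS, Equiv.symm_apply_eq, ← π.dual_riesz, Equiv.apply_symm_apply]
  refine ⟨starRingEnd ℂ c, fun ℓ => ?_⟩
  have h : riesz.symm (S (riesz (riesz.symm ℓ))) = c • riesz.symm ℓ := hc (riesz.symm ℓ)
  rw [Equiv.apply_symm_apply, Equiv.symm_apply_eq, riesz_smul, Equiv.apply_symm_apply] at h
  exact h

end Schur

section TensorHom

variable {Vκ : Type*} [NormedAddCommGroup Vκ] [InnerProductSpace ℂ Vκ] [FiniteDimensional ℂ Vκ]
  [CompleteSpace Vκ]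
  {Vγ : Type*} [NormedAddCommGroup Vγ] [InnerProductSpace ℂ Vγ] [FiniteDimensional ℂ Vγ]
  [CompleteSpace Vγ]

theorem tensorHom_apply (T : Vκ ⊗[ℂ] Vγ) (ℓ : DualSpace Vκ) :
    tensorHom T ℓ = TensorProduct.lid ℂ Vγ
      (LinearMap.rTensor Vγ ((show StrongDual ℂ Vκ from ℓ : StrongDual ℂ Vκ) : Vκ →ₗ[ℂ] ℂ) T) := rfl

theorem tensorHom_tmul (v : Vκ) (w : Vγ) (ℓ : DualSpace Vκ) :
    tensorHom (v ⊗ₜ[ℂ] w) ℓ = (show StrongDual ℂ Vκ from ℓ) v • w := rfl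

theorem tensorHom_zero (ℓ : DualSpace Vκ) : tensorHom (0 : Vκ ⊗[ℂ] Vγ) ℓ = 0 := by
  simp [tensorHom_apply]

theorem tensorHom_add (T T' : Vκ ⊗[ℂ] Vγ) (ℓ : DualSpace Vκ) :
    tensorHom (T + T') ℓ = tensorHom T ℓ + tensorHom T' ℓ := by
  simp [tensorHom_apply]

theorem tensorHom_lTensor (S : Vγ →ₗ[ℂ] Vγ) (T : Vκ ⊗[ℂ] Vγ) (ℓ : DualSpace Vκ) :
    tensorHom (LinearMap.lTensor Vκ S T) ℓ = S (tensorHom T ℓ) := by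
  induction T using TensorProduct.induction_on with
  | zero => simp [tensorHom_zero]
  | tmul v w => simp [tensorHom_tmul]
  | add a b ha hb => rw [map_add, tensorHom_add, ha, hb, tensorHom_add, map_add]

/-- The Hilbert–Schmidt inner product of the operators `T`, `T'` is the inner product of the
tensors. -/
theorem sum_inner_tensorHom {ι : Type*} [Fintype ι] (b : OrthonormalBasis ι ℂ Vκ)
    (T T' : Vκ ⊗[ℂ] Vγ) :
    ∑ i, inner ℂ (tensorHom T (riesz (b i))) (tensorHom T' (riesz (b i))) = inner ℂ T T' := by
  induction T using TensorProduct.induction_on with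
  | zero => simp [tensorHom_zero]
  | add x y hx hy =>
    simp only [tensorHom_add, inner_add_left, Finset.sum_add_distrib, hx, hy]
  | tmul v w =>
    induction T' using TensorProduct.induction_on with
    | zero => simp [tensorHom_zero]
    | add x y hx hy =>
      simp only [tensorHom_add, inner_add_right, Finset.sum_add_distrib, hx, hy]
    | tmul v' w' =>
      simp only [tensorHom_tmul, riesz_apply, inner_smul_left, inner_smul_right,
        TensorProduct.inner_tmul, inner_conj_symm]
      rw [← b.sum_inner_mul_inner v v', Finset.sum_mul]
      exact Finset.sum_congr rfl fun i _ => by ring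

theorem tensorHom_injective {T T' : Vκ ⊗[ℂ] Vγ} (h : ∀ ℓ, tensorHom T ℓ = tensorHom T' ℓ) :
    T = T' :=
  ext_inner_left ℂ fun S => by
    rw [← sum_inner_tensorHom (stdOrthonormalBasis ℂ Vκ), ← sum_inner_tensorHom
      (stdOrthonormalBasis ℂ Vκ)]
    simp only [h]

end TensorHom

section Equivariance

variable {E : Type*} [NormedAddCommGroup E] [NormedSpace ℝ E] [CompleteSpace E]
  {G : Type*} [TopologicalSpace G] [ChartedSpace E G] [Group G] [LieGroup 𝓘(ℝ, E) ∞ G]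
  [IsTopologicalGroup G] [MeasurableSpace G] [BorelSpace G] [SecondCountableTopology G]
  {D : IwasawaData E G} {Γ : Subgroup G}
  {Vκ : Type*} [NormedAddCommGroup Vκ] [InnerProductSpace ℂ Vκ] [FiniteDimensional ℂ Vκ]
  [CompleteSpace Vκ]
  {Vγ : Type*} [NormedAddCommGroup Vγ] [InnerProductSpace ℂ Vγ] [FiniteDimensional ℂ Vγ]
  [CompleteSpace Vγ] {κ : UnitaryRep D.M Vκ} {γ : UnitaryRep D.K Vγ}

theorem tensorHom_dual (T : invariants κ γ) (m : D.M) (ℓ : DualSpace Vκ) :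
    tensorHom (T : Vκ ⊗[ℂ] Vγ) (κ.dual m ℓ) =
      γ.toHom (m : D.K) (tensorHom (T : Vκ ⊗[ℂ] Vγ) ℓ) := by
  conv_lhs => rw [← T.2 m]
  generalize (T : Vκ ⊗[ℂ] Vγ) = t
  induction t using TensorProduct.induction_on with
  | zero => simp [tensorHom_zero]
  | tmul v w =>
    rw [TensorProduct.map_tmul, tensorHom_tmul, tensorHom_tmul, map_smul]
    congr 1
    exact congrArg (show StrongDual ℂ Vκ from ℓ) ((κ.toHom m).symm_apply_apply v)
  | add a b ha hb => rw [map_add, tensorHom_add, ha, hb, tensorHom_add, map_add]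

theorem adjoint_tensorHom_apply (T : invariants κ γ) (m : D.M) (w : Vγ) :
    ContinuousLinearMap.adjoint (tensorHom (T : Vκ ⊗[ℂ] Vγ)) (γ.toHom (m : D.K) w) =
      κ.dual m (ContinuousLinearMap.adjoint (tensorHom (T : Vκ ⊗[ℂ] Vγ)) w) := by
  refine ext_inner_left ℂ fun ℓ => ?_
  rw [ContinuousLinearMap.adjoint_inner_right, ← (κ.dual m).symm.inner_map_map ℓ,
    LinearIsometryEquiv.symm_apply_apply, ContinuousLinearMap.adjoint_inner_right,
    ← (γ.toHom (m : D.K)).inner_map_map (tensorHom (T : Vκ ⊗[ℂ] Vγ) _) w, ← tensorHom_dual,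
    LinearIsometryEquiv.apply_symm_apply]

/-- By Schur's lemma `T* T'` is scalar for `T, T' ∈ [V_κ ⊗ V_γ]^M`, and its trace is `⟨T, T'⟩`. -/
theorem adjoint_tensorHom_tensorHom (hκ : κ.IsIrreducible) (T T' : invariants κ γ)
    (ℓ : DualSpace Vκ) :
    (Module.finrank ℂ Vκ : ℂ) • ContinuousLinearMap.adjoint (tensorHom (T : Vκ ⊗[ℂ] Vγ))
      (tensorHom (T' : Vκ ⊗[ℂ] Vγ) ℓ) = inner ℂ (T : Vκ ⊗[ℂ] Vγ) (T' : Vκ ⊗[ℂ] Vγ) • ℓ := by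
  obtain ⟨c, hc⟩ := hκ.dual_exists_eq_smul
    ((ContinuousLinearMap.adjoint (tensorHom (T : Vκ ⊗[ℂ] Vγ))).comp
      (tensorHom (T' : Vκ ⊗[ℂ] Vγ))) fun m ℓ => by
    rw [ContinuousLinearMap.comp_apply, tensorHom_dual, adjoint_tensorHom_apply]; rfl
  have hc' : ∀ ℓ, ContinuousLinearMap.adjoint (tensorHom (T : Vκ ⊗[ℂ] Vγ))
      (tensorHom (T' : Vκ ⊗[ℂ] Vγ) ℓ) = c • ℓ := hc
  have h := sum_inner_tensorHom (stdOrthonormalBasis ℂ Vκ) (T : Vκ ⊗[ℂ] Vγ) (T' : Vκ ⊗[ℂ] Vγ)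
  have h1 : ∀ i, inner ℂ (tensorHom (T : Vκ ⊗[ℂ] Vγ) (riesz (stdOrthonormalBasis ℂ Vκ i)))
      (tensorHom (T' : Vκ ⊗[ℂ] Vγ) (riesz (stdOrthonormalBasis ℂ Vκ i))) = c := fun i => by
    rw [← ContinuousLinearMap.adjoint_inner_right, hc', inner_smul_right, inner_riesz,
      inner_self_eq_norm_sq_to_K, (stdOrthonormalBasis ℂ Vκ).norm_eq_one]
    simp
  simp only [h1, Finset.sum_const, Finset.card_univ, Fintype.card_fin, nsmul_eq_mul] at h
  rw [hc', smul_smul, h]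

theorem projEnd_apply (T : Vκ ⊗[ℂ] Vγ) (w : Vγ) : projEnd T w = (Module.finrank ℂ Vκ : ℂ) •
    tensorHom T (ContinuousLinearMap.adjoint (tensorHom T) w) := rfl

theorem inner_self_of_norm_eq_one {T : invariants κ γ} (hT : ‖T‖ = 1) :
    inner ℂ (T : Vκ ⊗[ℂ] Vγ) (T : Vκ ⊗[ℂ] Vγ) = 1 := by
  refine (inner_self_eq_norm_sq_to_K (𝕜 := ℂ) (T : Vκ ⊗[ℂ] Vγ)).trans ?_
  rw [show ‖(T : Vκ ⊗[ℂ] Vγ)‖ = 1 from hT]; simp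

theorem projEnd_tensorHom (hκ : κ.IsIrreducible) {T : invariants κ γ} (hT : ‖T‖ = 1)
    (ℓ : DualSpace Vκ) :
    projEnd (T : Vκ ⊗[ℂ] Vγ) (tensorHom (T : Vκ ⊗[ℂ] Vγ) ℓ) = tensorHom (T : Vκ ⊗[ℂ] Vγ) ℓ := by
  rw [projEnd_apply, ← map_smul, adjoint_tensorHom_tensorHom hκ, inner_self_of_norm_eq_one hT,
    one_smul]

theorem projEnd_mul_self (hκ : κ.IsIrreducible) {T : invariants κ γ} (hT : ‖T‖ = 1) :
    projEnd (T : Vκ ⊗[ℂ] Vγ) * projEnd (T : Vκ ⊗[ℂ] Vγ) = projEnd (T : Vκ ⊗[ℂ] Vγ) := by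
  ext w
  change projEnd (T : Vκ ⊗[ℂ] Vγ) (projEnd (T : Vκ ⊗[ℂ] Vγ) w) = _
  rw [projEnd_apply _ w, map_smul, projEnd_tensorHom hκ hT]

theorem projEnd_mul_projEnd_mul_projEnd (hκ : κ.IsIrreducible) (T T' : invariants κ γ) :
    projEnd (T : Vκ ⊗[ℂ] Vγ) * projEnd (T' : Vκ ⊗[ℂ] Vγ) * projEnd (T : Vκ ⊗[ℂ] Vγ) =
      (inner ℂ (T : Vκ ⊗[ℂ] Vγ) (T' : Vκ ⊗[ℂ] Vγ) * inner ℂ (T' : Vκ ⊗[ℂ] Vγ) (T : Vκ ⊗[ℂ] Vγ)) •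
        projEnd (T : Vκ ⊗[ℂ] Vγ) := by
  ext w
  change projEnd (T : Vκ ⊗[ℂ] Vγ) (projEnd (T' : Vκ ⊗[ℂ] Vγ) (projEnd (T : Vκ ⊗[ℂ] Vγ) w)) =
    (inner ℂ (T : Vκ ⊗[ℂ] Vγ) (T' : Vκ ⊗[ℂ] Vγ) * inner ℂ (T' : Vκ ⊗[ℂ] Vγ) (T : Vκ ⊗[ℂ] Vγ)) •
      projEnd (T : Vκ ⊗[ℂ] Vγ) w
  rw [projEnd_apply _ w, map_smul, projEnd_apply (T' : Vκ ⊗[ℂ] Vγ), ← map_smul,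
    adjoint_tensorHom_tensorHom hκ, projEnd_apply, map_smul, map_smul,
    ← map_smul (tensorHom (T : Vκ ⊗[ℂ] Vγ)), adjoint_tensorHom_tensorHom hκ, map_smul, map_smul]
  module

theorem lTensor_projEnd (hκ : κ.IsIrreducible) {T : invariants κ γ} (hT : ‖T‖ = 1) :
    LinearMap.lTensor Vκ (projEnd (T : Vκ ⊗[ℂ] Vγ) : Vγ →ₗ[ℂ] Vγ) (T : Vκ ⊗[ℂ] Vγ) = T :=
  tensorHom_injective fun ℓ => by
    rw [tensorHom_lTensor]; exact projEnd_tensorHom hκ hT ℓ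

theorem projEnd_toHom (T : invariants κ γ) (m : D.M) (w : Vγ) :
    projEnd (T : Vκ ⊗[ℂ] Vγ) (γ.toHom (m : D.K) w) =
      γ.toHom (m : D.K) (projEnd (T : Vκ ⊗[ℂ] Vγ) w) := by
  rw [projEnd_apply, projEnd_apply, adjoint_tensorHom_apply, tensorHom_dual, map_smul]

theorem act_proj (T : invariants κ γ) (m : D.M) :
    act ((m : D.K) : G) (γ.toHom (m : D.K)) (proj Γ (T : Vκ ⊗[ℂ] Vγ)) =
      proj Γ (T : Vκ ⊗[ℂ] Vγ) := by
  ext x w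
  rw [act_apply]
  change γ.toHom (m : D.K) (projEnd (T : Vκ ⊗[ℂ] Vγ) ((γ.toHom (m : D.K)).symm w)) =
    projEnd (T : Vκ ⊗[ℂ] Vγ) w
  rw [← projEnd_toHom, LinearIsometryEquiv.apply_symm_apply]

theorem proj_mul_self (hκ : κ.IsIrreducible) {T : invariants κ γ} (hT : ‖T‖ = 1) :
    proj Γ (T : Vκ ⊗[ℂ] Vγ) * proj Γ (T : Vκ ⊗[ℂ] Vγ) = proj Γ (T : Vκ ⊗[ℂ] Vγ) :=
  ContinuousMap.ext fun _ => projEnd_mul_self hκ hT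

theorem isStarProjection_proj (hκ : κ.IsIrreducible) {T : invariants κ γ} (hT : ‖T‖ = 1) :
    IsStarProjection (proj Γ (T : Vκ ⊗[ℂ] Vγ)) :=
  ⟨proj_mul_self hκ hT, proj_star _⟩

end Equivariance

/-! ### Isotypic parts of `δ_T` -/

/-- Compact groups are unimodular: a right translate of a Haar measure is a multiple of it, and both
have the same total mass. -/
theorem isMulRightInvariant_of_compactSpace {K : Type*} [Group K] [TopologicalSpace K]
    [IsTopologicalGroup K] [CompactSpace K] [MeasurableSpace K] [BorelSpace K] (μ : Measure K)
    [μ.IsHaarMeasure] : μ.IsMulRightInvariant where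
  map_mul_right_eq_self g := by
    have h := Measure.isMulInvariant_eq_smul_of_compactSpace (Measure.map (· * g) μ) μ
    set c := Measure.haarScalarFactor (Measure.map (· * g) μ) μ
    have huniv := congrArg (fun ν => ν Set.univ) h
    simp only [Measure.smul_apply] at huniv
    rw [Measure.map_apply (measurable_mul_const g) MeasurableSet.univ, Set.preimage_univ] at huniv
    have hc : c = 1 := by
      have h1 : (c : ENNReal) * μ Set.univ = 1 * μ Set.univ := by rw [one_mul]; exact huniv.symm
      exact_mod_cast (ENNReal.mul_left_inj (isOpen_univ.measure_ne_zero μ ⟨1, trivial⟩)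
        (measure_ne_top μ _)).1 h1
    rw [h, hc, one_smul]

theorem UnitaryDual.continuous {H : Type*} [Group H] [TopologicalSpace H] (χ : UnitaryDual H) :
    Continuous χ.1 := by
  obtain ⟨n, π, -, hχ⟩ := χ.2
  rw [funext hχ]
  have h : Continuous fun h => (π.toHom h).toContinuousLinearEquiv.toContinuousLinearMap :=
    continuous_clm_apply.2 π.continuous'
  exact (LinearMap.continuous_of_finiteDimensional ((LinearMap.trace ℂ _).comp
    (ContinuousLinearMap.coeLM ℂ (M := EuclideanSpace ℂ (Fin n))))).comp h

theorem UnitaryDual.conj_eq {H : Type*} [Group H] [TopologicalSpace H] (χ : UnitaryDual H)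
    (g h : H) : χ.1 (g * h * g⁻¹) = χ.1 h := by
  obtain ⟨n, π, -, hχ⟩ := χ.2
  rw [hχ, hχ, map_mul, map_mul, map_inv]
  exact LinearMap.trace_conj' ((π.toHom h).toLinearEquiv : _ →ₗ[ℂ] _) (π.toHom g).toLinearEquiv

theorem inner_lTensor {V W : Type*} [NormedAddCommGroup V] [InnerProductSpace ℂ V]
    [NormedAddCommGroup W] [InnerProductSpace ℂ W] [CompleteSpace W] (S : W →L[ℂ] W)
    (a b : V ⊗[ℂ] W) :
    inner ℂ (LinearMap.lTensor V (S : W →ₗ[ℂ] W) a) b =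
      inner ℂ a (LinearMap.lTensor V (ContinuousLinearMap.adjoint S : W →ₗ[ℂ] W) b) := by
  induction a using TensorProduct.induction_on with
  | zero => simp
  | add x y hx hy => rw [map_add, inner_add_left, inner_add_left, hx, hy]
  | tmul v w =>
    induction b using TensorProduct.induction_on with
    | zero => simp
    | add x y hx hy => rw [map_add, inner_add_right, inner_add_right, hx, hy]
    | tmul v' w' =>
      simp only [LinearMap.lTensor_tmul, TensorProduct.inner_tmul, ContinuousLinearMap.coe_coe,
        ContinuousLinearMap.adjoint_inner_right]

section Sections

variable {E : Type*} [NormedAddCommGroup E] [NormedSpace ℝ E] [CompleteSpace E]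
  {G : Type*} [TopologicalSpace G] [ChartedSpace E G] [Group G] [LieGroup 𝓘(ℝ, E) ∞ G]
  [IsTopologicalGroup G] [MeasurableSpace G] [BorelSpace G] [SecondCountableTopology G]
  {D : IwasawaData E G} {Γ : Subgroup G}
  {Vκ : Type*} [NormedAddCommGroup Vκ] [InnerProductSpace ℂ Vκ] [FiniteDimensional ℂ Vκ]
  {Vγ : Type*} [NormedAddCommGroup Vγ] [InnerProductSpace ℂ Vγ] [FiniteDimensional ℂ Vγ]
  {κ : UnitaryRep D.M Vκ} {γ : UnitaryRep D.K Vγ}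

/-- The operator `1 ⊗ S` on sections of `(K ×_M V_κ) ⊗ V_γ`. -/
noncomputable def mapSection (S : Vγ →L[ℂ] Vγ) (φ : sections Vγ κ) : sections Vγ κ :=
  ⟨⟨fun k => LinearMap.lTensor Vκ (S : Vγ →ₗ[ℂ] Vγ) ((φ : C(D.K, Vκ ⊗[ℂ] Vγ)) k),
      (LinearMap.continuous_of_finiteDimensional _).comp
        (φ : C(D.K, Vκ ⊗[ℂ] Vγ)).continuous⟩, fun m k => by
    change LinearMap.lTensor Vκ _ ((φ : C(D.K, Vκ ⊗[ℂ] Vγ)) (k * m)) =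
      LinearMap.rTensor Vγ _ (LinearMap.lTensor Vκ _ _)
    rw [φ.2 m k, ← LinearMap.comp_apply, ← LinearMap.comp_apply, LinearMap.lTensor_comp_rTensor,
      LinearMap.rTensor_comp_lTensor]⟩

/-- Left translation of sections. -/
noncomputable def translateSection (h : D.K) (φ : sections Vγ κ) : sections Vγ κ :=
  ⟨leftTranslate h (φ : C(D.K, Vκ ⊗[ℂ] Vγ)), fun m k => by
    change (φ : C(D.K, Vκ ⊗[ℂ] Vγ)) (h⁻¹ * (k * m)) = _
    rw [← mul_assoc]
    exact φ.2 m _⟩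

variable (γ) in
/-- The action of `K` on sections of `(K ×_M V_κ) ⊗ V_γ`, for which `ψ_T` is invariant. -/
noncomputable def actSection (h : D.K) (φ : sections Vγ κ) : sections Vγ κ :=
  mapSection (γ.toHom h).toContinuousLinearEquiv.toContinuousLinearMap (translateSection h φ)

theorem mapSection_apply (S : Vγ →L[ℂ] Vγ) (φ : sections Vγ κ) (k : D.K) :
    (mapSection S φ : C(D.K, Vκ ⊗[ℂ] Vγ)) k =
      LinearMap.lTensor Vκ (S : Vγ →ₗ[ℂ] Vγ) ((φ : C(D.K, Vκ ⊗[ℂ] Vγ)) k) := rfl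

theorem translateSection_apply (h : D.K) (φ : sections Vγ κ) (k : D.K) :
    (translateSection h φ : C(D.K, Vκ ⊗[ℂ] Vγ)) k = (φ : C(D.K, Vκ ⊗[ℂ] Vγ)) (h⁻¹ * k) := rfl

theorem integrable_isotypic (χ : UnitaryDual D.K) (φ : sections Vγ κ) (k : D.K) :
    Integrable (fun h => (starRingEnd ℂ (χ.1 h)) • (φ : C(D.K, Vκ ⊗[ℂ] Vγ)) (h⁻¹ * k)) D.haarK :=
  ((Complex.continuous_conj.comp χ.continuous).smul ((φ : C(D.K, Vκ ⊗[ℂ] Vγ)).continuous.comp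
    (continuous_inv.mul continuous_const))).integrable_of_hasCompactSupport
    (HasCompactSupport.of_compactSpace _)

theorem IsIsotypic.mapSection {χ : UnitaryDual D.K} {φ : sections Vγ κ} (hφ : IsIsotypic χ φ)
    (S : Vγ →L[ℂ] Vγ) : IsIsotypic χ (mapSection S φ) := by
  intro k
  simp only [mapSection_apply]
  have h := ContinuousLinearMap.integral_comp_comm
    (LinearMap.lTensor Vκ (S : Vγ →ₗ[ℂ] Vγ)).toContinuousLinearMap (integrable_isotypic χ φ k)
  simp only [map_smul, LinearMap.coe_toContinuousLinearMap'] at h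
  rw [h, ← map_smul, ← hφ k]

instance : D.haarK.IsMulRightInvariant := isMulRightInvariant_of_compactSpace _

/-- Translation preserves isotypic sections because characters are class functions and `K` is
unimodular. -/
theorem IsIsotypic.translateSection {χ : UnitaryDual D.K} {φ : sections Vγ κ}
    (hφ : IsIsotypic χ φ) (g : D.K) : IsIsotypic χ (translateSection g φ) := by
  intro k
  simp only [translateSection_apply]
  rw [hφ (g⁻¹ * k)]
  congr 1
  rw [← integral_mul_left_eq_self (fun h => (starRingEnd ℂ (χ.1 h)) •
      (φ : C(D.K, Vκ ⊗[ℂ] Vγ)) (g⁻¹ * (h⁻¹ * k))) g,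
    ← integral_mul_right_eq_self (fun h => (starRingEnd ℂ (χ.1 (g * h))) •
      (φ : C(D.K, Vκ ⊗[ℂ] Vγ)) (g⁻¹ * ((g * h)⁻¹ * k))) g⁻¹]
  refine integral_congr_ae (.of_forall fun h => ?_)
  simp only
  rw [← mul_assoc g h, χ.conj_eq]
  congr 2
  group

theorem IsIsotypic.sub {χ : UnitaryDual D.K} {φ ψ : sections Vγ κ} (hφ : IsIsotypic χ φ)
    (hψ : IsIsotypic χ ψ) : IsIsotypic χ (φ - ψ) := by
  intro k
  have h := integral_sub (integrable_isotypic χ φ k) (integrable_isotypic χ ψ k)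
  simp only [← smul_sub] at h
  calc ((φ - ψ : sections Vγ κ) : C(D.K, Vκ ⊗[ℂ] Vγ)) k
      = (φ : C(D.K, Vκ ⊗[ℂ] Vγ)) k - (ψ : C(D.K, Vκ ⊗[ℂ] Vγ)) k := rfl
    _ = _ := by
      conv_lhs => rw [hφ k, hψ k]
      exact (smul_sub _ _ _).symm.trans (congrArg _ h.symm)

theorem integrable_inner_sections (φ ψ : sections Vγ κ) :
    Integrable (fun k => inner ℂ ((φ : C(D.K, Vκ ⊗[ℂ] Vγ)) k) ((ψ : C(D.K, Vκ ⊗[ℂ] Vγ)) k))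
      D.haarK :=
  ((φ : C(D.K, Vκ ⊗[ℂ] Vγ)).continuous.inner
    (ψ : C(D.K, Vκ ⊗[ℂ] Vγ)).continuous).integrable_of_hasCompactSupport
    (HasCompactSupport.of_compactSpace _)

/-- Uniqueness of isotypic parts: the difference of two candidates is isotypic and pairs to zero
with itself. -/
theorem IsIsotypicPart.eq_of_isIsotypic {d : sections Vγ κ → ℂ} {χ : UnitaryDual D.K}
    {ψ ψ' : sections Vγ κ} (hψ : IsIsotypicPart d χ ψ) (hψ' : IsIsotypic χ ψ')
    (h : ∀ φ : sections Vγ κ, IsIsotypic χ φ → ∫ k, inner ℂ ((ψ' : C(D.K, Vκ ⊗[ℂ] Vγ)) k)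
      ((φ : C(D.K, Vκ ⊗[ℂ] Vγ)) k) ∂D.haarK = d φ) : ψ' = ψ := by
  set u : sections Vγ κ := ψ' - ψ with hu_def
  have hu : IsIsotypic χ u := hψ'.sub hψ.2.1
  have h0 : ∫ k, inner ℂ ((u : C(D.K, Vκ ⊗[ℂ] Vγ)) k) ((u : C(D.K, Vκ ⊗[ℂ] Vγ)) k) ∂D.haarK
      = 0 := by
    have h1 : ∀ k, inner ℂ ((u : C(D.K, Vκ ⊗[ℂ] Vγ)) k) ((u : C(D.K, Vκ ⊗[ℂ] Vγ)) k) =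
        inner ℂ ((ψ' : C(D.K, Vκ ⊗[ℂ] Vγ)) k) ((u : C(D.K, Vκ ⊗[ℂ] Vγ)) k) -
        inner ℂ ((ψ : C(D.K, Vκ ⊗[ℂ] Vγ)) k) ((u : C(D.K, Vκ ⊗[ℂ] Vγ)) k) := fun k =>
      inner_sub_left _ _ _
    simp only [h1]
    rw [integral_sub (integrable_inner_sections ψ' u) (integrable_inner_sections ψ u), h u hu,
      hψ.2.2 u hu, sub_self]
  have hnorm : ∫ k, ‖(u : C(D.K, Vκ ⊗[ℂ] Vγ)) k‖ ^ 2 ∂D.haarK = 0 := by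
    have h2 : ∀ k, inner ℂ ((u : C(D.K, Vκ ⊗[ℂ] Vγ)) k) ((u : C(D.K, Vκ ⊗[ℂ] Vγ)) k) =
        ((‖(u : C(D.K, Vκ ⊗[ℂ] Vγ)) k‖ ^ 2 : ℝ) : ℂ) := fun k => by
      refine (inner_self_eq_norm_sq_to_K (𝕜 := ℂ) ((u : C(D.K, Vκ ⊗[ℂ] Vγ)) k)).trans ?_
      push_cast; rfl
    simp only [h2] at h0
    rw [integral_complex_ofReal] at h0
    exact_mod_cast h0
  have hcont : Continuous fun k => ‖(u : C(D.K, Vκ ⊗[ℂ] Vγ)) k‖ ^ 2 :=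
    (u : C(D.K, Vκ ⊗[ℂ] Vγ)).continuous.norm.pow 2
  have hzero : ∀ k, (u : C(D.K, Vκ ⊗[ℂ] Vγ)) k = 0 := by
    by_contra! hne
    obtain ⟨k, hk⟩ := hne
    have := hcont.integral_pos_of_hasCompactSupport_nonneg_nonzero (μ := D.haarK)
      (HasCompactSupport.of_compactSpace _) (fun _ => by positivity) (x := k) (by simpa using hk)
    exact this.ne' hnorm
  exact sub_eq_zero.1 (Subtype.ext (ContinuousMap.ext hzero))

/-- If `1 ⊗ S` is self-adjoint and fixes `T`, then it fixes the isotypic parts of `δ_T`. -/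
theorem isIsotypicPart_mapSection_eq [CompleteSpace Vγ] {T : invariants κ γ} {χ : UnitaryDual D.K}
    {ψ : sections Vγ κ} (hψ : IsIsotypicPart (delta T) χ ψ) {S : Vγ →L[ℂ] Vγ}
    (hS : ContinuousLinearMap.adjoint S = S)
    (hT : LinearMap.lTensor Vκ (S : Vγ →ₗ[ℂ] Vγ) (T : Vκ ⊗[ℂ] Vγ) = T) :
    mapSection S ψ = ψ := by
  refine hψ.eq_of_isIsotypic (hψ.2.1.mapSection S) fun φ hφ => ?_
  simp only [mapSection_apply, inner_lTensor, hS]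
  refine (hψ.2.2 (mapSection S φ) (hφ.mapSection S)).trans ?_
  simp only [delta, mapSection_apply]
  conv_lhs => rw [← hS]
  rw [← inner_lTensor, hT]

theorem inner_lTensor_isometry (u : Vγ ≃ₗᵢ[ℂ] Vγ) (a b : Vκ ⊗[ℂ] Vγ) :
    inner ℂ (LinearMap.lTensor Vκ (u.toContinuousLinearEquiv.toContinuousLinearMap : Vγ →ₗ[ℂ] Vγ) a)
      (LinearMap.lTensor Vκ (u.toContinuousLinearEquiv.toContinuousLinearMap : Vγ →ₗ[ℂ] Vγ) b) =
      inner ℂ a b :=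
  TensorProduct.inner_map_map (LinearIsometry.id) u.toLinearIsometry a b

theorem actSection_actSection_inv (h : D.K) (φ : sections Vγ κ) :
    actSection γ h (actSection γ h⁻¹ φ) = φ := by
  refine Subtype.ext (ContinuousMap.ext fun k => ?_)
  simp only [actSection, mapSection_apply, translateSection_apply]
  rw [← LinearMap.comp_apply, ← LinearMap.lTensor_comp]
  have h1 : ((γ.toHom h).toContinuousLinearEquiv.toContinuousLinearMap : Vγ →ₗ[ℂ] Vγ) ∘ₗ
      ((γ.toHom h⁻¹).toContinuousLinearEquiv.toContinuousLinearMap : Vγ →ₗ[ℂ] Vγ) =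
        LinearMap.id := by
    ext v
    change γ.toHom h (γ.toHom h⁻¹ v) = v
    rw [← γ.symm_eq, LinearIsometryEquiv.apply_symm_apply]
  rw [h1, LinearMap.lTensor_id]
  simp

/-- The distribution `δ_T` is `M`-invariant. -/
theorem delta_actSection (T : invariants κ γ) (m : D.M) (φ : sections Vγ κ) :
    delta T (actSection γ (m : D.K) φ) = delta T φ := by
  have h : (actSection γ (m : D.K) φ : C(D.K, Vκ ⊗[ℂ] Vγ)) 1 =
      TensorProduct.map ((κ.toHom m).toLinearEquiv : Vκ →ₗ[ℂ] Vκ)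
        ((γ.toHom (m : D.K)).toLinearEquiv : Vγ →ₗ[ℂ] Vγ) ((φ : C(D.K, Vκ ⊗[ℂ] Vγ)) 1) := by
    simp only [actSection, mapSection_apply, translateSection_apply]
    have h1 := φ.2 m⁻¹ 1
    rw [inv_inv, one_mul] at h1
    rw [mul_one]
    change LinearMap.lTensor Vκ _ ((φ : C(D.K, Vκ ⊗[ℂ] Vγ)) ((m⁻¹ : D.M) : D.K)) = _
    rw [h1, ← LinearMap.comp_apply, LinearMap.lTensor_comp_rTensor]
    rfl
  simp only [delta]
  rw [h]
  conv_lhs => rw [← T.2 m]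
  exact TensorProduct.inner_map_map (κ.toHom m).toLinearIsometry
    (γ.toHom (m : D.K)).toLinearIsometry _ _

/-- The isotypic parts of `δ_T` are `M`-invariant. -/
theorem isIsotypicPart_actSection_eq {T : invariants κ γ} {χ : UnitaryDual D.K}
    {ψ : sections Vγ κ} (hψ : IsIsotypicPart (delta T) χ ψ) (m : D.M) :
    actSection γ (m : D.K) ψ = ψ := by
  refine hψ.eq_of_isIsotypic ((hψ.2.1.translateSection _).mapSection _) fun φ hφ => ?_
  have hφ' : IsIsotypic χ (actSection γ (m : D.K)⁻¹ φ) := (hφ.translateSection _).mapSection _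
  have h : ∀ k, inner ℂ ((actSection γ (m : D.K) ψ : C(D.K, Vκ ⊗[ℂ] Vγ)) k)
      ((φ : C(D.K, Vκ ⊗[ℂ] Vγ)) k) = inner ℂ ((ψ : C(D.K, Vκ ⊗[ℂ] Vγ)) ((m : D.K)⁻¹ * k))
        ((actSection γ (m : D.K)⁻¹ φ : C(D.K, Vκ ⊗[ℂ] Vγ)) ((m : D.K)⁻¹ * k)) := fun k => by
    conv_lhs => rw [← actSection_actSection_inv (γ := γ) (m : D.K) φ]
    exact inner_lTensor_isometry _ _ _
  simp only [h]
  rw [integral_mul_left_eq_self (fun k => inner ℂ ((ψ : C(D.K, Vκ ⊗[ℂ] Vγ)) k)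
    ((actSection γ (m : D.K)⁻¹ φ : C(D.K, Vκ ⊗[ℂ] Vγ)) k)), hψ.2.2 _ hφ']
  exact delta_actSection T m⁻¹ φ

theorem actSection_psi (T : invariants κ γ) (h : D.K) : actSection γ h (psi T) = psi T := by
  refine Subtype.ext (ContinuousMap.ext fun k => ?_)
  change LinearMap.lTensor Vκ _ (LinearMap.lTensor Vκ _ _) = LinearMap.lTensor Vκ _ _
  rw [← LinearMap.comp_apply, ← LinearMap.lTensor_comp]
  congr 2
  ext v
  change γ.toHom h (γ.toHom (h⁻¹ * k) v) = γ.toHom k v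
  have := congrArg (fun u => u v) (map_mul γ.toHom h (h⁻¹ * k))
  rw [mul_inv_cancel_left] at this
  exact this.symm

end Sections

/-! ### Equivariance of `σ^ξ_{φ,ψ}` -/

section Sigma

variable {E : Type*} [NormedAddCommGroup E] [NormedSpace ℝ E] [CompleteSpace E]
  {G : Type*} [TopologicalSpace G] [ChartedSpace E G] [Group G] [LieGroup 𝓘(ℝ, E) ∞ G]
  [IsTopologicalGroup G] [MeasurableSpace G] [BorelSpace G] [SecondCountableTopology G]
  {D : IwasawaData E G} {Γ : Subgroup G} {ν : Measure (RightCosets Γ)}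
  {Vκ : Type*} [NormedAddCommGroup Vκ] [InnerProductSpace ℂ Vκ] [FiniteDimensional ℂ Vκ]
  {Vγ : Type*} [NormedAddCommGroup Vγ] [InnerProductSpace ℂ Vγ] [FiniteDimensional ℂ Vγ]
  {κ : UnitaryRep D.M Vκ} {γ : UnitaryRep D.K Vγ}

theorem decomp_choose_of_mem_K (k : D.K) : (D.decomp (k : G)).choose = (k, 1, 1) :=
  ((D.decomp (k : G)).choose_spec.2 (k, 1, 1) (by simp)).symm

theorem kPart_coe (k : D.K) : D.kPart (k : G) = k := by
  rw [IwasawaData.kPart, decomp_choose_of_mem_K]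

theorem aPart_coe (k : D.K) : D.aPart (k : G) = 1 := by
  rw [IwasawaData.aPart, decomp_choose_of_mem_K]

variable (D) in
/-- The factor `a(1)^{iλ-ρ}` by which the formula for `π^{κ,iλ}(1)` multiplies sections. Since
`log 1` is a chosen preimage of `1` under the exponential map, it is not `1` by definition. -/
noncomputable def unitFactor (l : Module.Dual ℝ D.𝔞) : ℂ :=
  Complex.exp (Complex.I * (l (D.log 1) : ℝ) - (D.rho (D.log 1) : ℝ))

theorem isPrincipalAction_of_mem_K {l : Module.Dual ℝ D.𝔞} {h : D.K} {φ φ' : principalSpace κ}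
    (hφ : ∀ᵐ k ∂D.haarK, (φ' : Lp Vκ 2 D.haarK) k =
      unitFactor D l • (φ : Lp Vκ 2 D.haarK) (h⁻¹ * k)) : IsPrincipalAction κ l (h : G) φ φ' := by
  filter_upwards [hφ] with k hk
  have h1 : ((h : G)⁻¹ * (k : G)) = ((h⁻¹ * k : D.K) : G) := rfl
  rw [hk, h1, kPart_coe, aPart_coe]
  rfl

/-- An embedding intertwines the actions of the identity of `G`, which forces the factor to be `1`
unless the space is zero. -/
theorem IsEmbedding.unitFactor_smul {l : Module.Dual ℝ D.𝔞} {ξ : principalSpace κ →ₗᵢ[ℂ] Lp ℂ 2 ν}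
    (hξ : IsEmbedding κ l ξ) (φ : principalSpace κ) : unitFactor D l • φ = φ := by
  refine ξ.injective (Lp.ext ?_)
  have h := hξ ((1 : D.K) : G) φ (unitFactor D l • φ) (isPrincipalAction_of_mem_K (by
    filter_upwards [Lp.coeFn_smul (unitFactor D l) (φ : Lp Vκ 2 D.haarK)] with k hk
    rw [inv_one, one_mul]
    exact hk))
  filter_upwards [h] with x hx
  rw [hx, Subgroup.coe_one, mulRight_one]

theorem component_coeFn (w : Vγ) (φ : sections Vγ κ) :
    ((component w φ : principalSpace κ) : Lp Vκ 2 D.haarK) =ᵐ[D.haarK]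
      fun k => slice Vκ w ((φ : C(D.K, Vκ ⊗[ℂ] Vγ)) k) :=
  ContinuousMap.coeFn_toLp (p := 2) (𝕜 := ℂ) D.haarK _

theorem IsEmbedding.component_translateSection {l : Module.Dual ℝ D.𝔞}
    {ξ : principalSpace κ →ₗᵢ[ℂ] Lp ℂ 2 ν} (hξ : IsEmbedding κ l ξ) (w : Vγ) (φ : sections Vγ κ)
    (h : D.K) : ξ (component w (translateSection h φ)) =ᵐ[ν]
      fun x => ξ (component w φ) (x.mulRight (h : G)) := by
  refine hξ (h : G) (component w φ) (component w (translateSection h φ))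
    (isPrincipalAction_of_mem_K ?_)
  rw [← hξ.unitFactor_smul (component w (translateSection h φ))]
  filter_upwards [Lp.coeFn_smul (unitFactor D l)
      ((component w (translateSection h φ) : principalSpace κ) : Lp Vκ 2 D.haarK),
    component_coeFn w (translateSection h φ),
    (measurePreserving_mul_left D.haarK h⁻¹).quasiMeasurePreserving.ae
      (component_coeFn w φ)] with k h1 h2 h3
  refine h1.trans ?_
  rw [Pi.smul_apply, h2, h3]
  rfl

theorem IsEmbedding.embed_translateSection {l : Module.Dual ℝ D.𝔞}
    {ξ : principalSpace κ →ₗᵢ[ℂ] Lp ℂ 2 ν} (hξ : IsEmbedding κ l ξ) (φ : sections Vγ κ)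
    (h : D.K) : embed ξ (translateSection h φ) =ᵐ[ν] fun x => embed ξ φ (x.mulRight (h : G)) := by
  have hall := ae_all_iff.2 fun i =>
    hξ.component_translateSection (stdOrthonormalBasis ℂ Vγ i) φ h
  filter_upwards [hall] with x hx
  simp only [embed, hx]

theorem slice_lTensor [CompleteSpace Vγ] (w : Vγ) (S : Vγ →L[ℂ] Vγ) (t : Vκ ⊗[ℂ] Vγ) :
    slice Vκ w (LinearMap.lTensor Vκ (S : Vγ →ₗ[ℂ] Vγ) t) =
      slice Vκ (ContinuousLinearMap.adjoint S w) t := by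
  induction t using TensorProduct.induction_on with
  | zero => simp
  | tmul a b => simp [slice, ContinuousLinearMap.adjoint_inner_left]
  | add a b ha hb => simp only [map_add, ha, hb]

theorem slice_sum {ι : Type*} (s : Finset ι) (c : ι → ℂ) (w : ι → Vγ) (t : Vκ ⊗[ℂ] Vγ) :
    slice Vκ (∑ i ∈ s, c i • w i) t = ∑ i ∈ s, starRingEnd ℂ (c i) • slice Vκ (w i) t := by
  induction t using TensorProduct.induction_on with
  | zero => simp
  | tmul a b => simp [slice, Finset.sum_smul, mul_smul]
  | add a b ha hb => simp only [map_add, ha, hb, smul_add, Finset.sum_add_distrib]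

theorem component_mapSection [CompleteSpace Vγ] (w : Vγ) (S : Vγ →L[ℂ] Vγ) (φ : sections Vγ κ) :
    component w (mapSection S φ) = ∑ j, inner ℂ w (S (stdOrthonormalBasis ℂ Vγ j)) •
      component (stdOrthonormalBasis ℂ Vγ j) φ := by
  have hw : ∑ j, inner ℂ (S (stdOrthonormalBasis ℂ Vγ j)) w • stdOrthonormalBasis ℂ Vγ j =
      ContinuousLinearMap.adjoint S w := by
    rw [← (stdOrthonormalBasis ℂ Vγ).sum_repr' (ContinuousLinearMap.adjoint S w)]
    simp only [ContinuousLinearMap.adjoint_inner_right]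
  have hL : ∀ ψ : sections Vγ κ, ∀ v : Vγ, ((component v ψ : principalSpace κ) : Lp Vκ 2 D.haarK) =
      ContinuousMap.toLp 2 D.haarK ℂ ⟨fun k => slice Vκ v ((ψ : C(D.K, Vκ ⊗[ℂ] Vγ)) k),
        (continuous_slice v).comp (ψ : C(D.K, Vκ ⊗[ℂ] Vγ)).continuous⟩ := fun _ _ => rfl
  refine Subtype.ext ?_
  rw [AddSubmonoidClass.coe_finsetSum]
  simp only [SetLike.val_smul, hL, ← map_smul, ← map_sum]
  congr 1
  ext k
  rw [ContinuousMap.sum_apply]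
  change slice Vκ w (LinearMap.lTensor Vκ _ _) = ∑ j, inner ℂ w (S (stdOrthonormalBasis ℂ Vγ j)) •
    slice Vκ (stdOrthonormalBasis ℂ Vγ j) ((φ : C(D.K, Vκ ⊗[ℂ] Vγ)) k)
  rw [slice_lTensor, ← hw, slice_sum]
  simp only [inner_conj_symm]

/-- `ξ ⊗ 1` commutes with `1 ⊗ S`. -/
theorem embed_mapSection [CompleteSpace Vγ] (ξ : principalSpace κ →ₗᵢ[ℂ] Lp ℂ 2 ν)
    (S : Vγ →L[ℂ] Vγ) (φ : sections Vγ κ) :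
    embed ξ (mapSection S φ) =ᵐ[ν] fun x => S (embed ξ φ x) := by
  have h : ∀ i, ∀ᵐ x ∂ν, ξ (component (stdOrthonormalBasis ℂ Vγ i) (mapSection S φ)) x =
      ∑ j, inner ℂ (stdOrthonormalBasis ℂ Vγ i) (S (stdOrthonormalBasis ℂ Vγ j)) *
        ξ (component (stdOrthonormalBasis ℂ Vγ j) φ) x := by
    intro i
    rw [component_mapSection, map_sum]
    simp only [map_smul]
    have h2 := ae_all_iff.2 fun j => Lp.coeFn_smul
      (inner ℂ (stdOrthonormalBasis ℂ Vγ i) (S (stdOrthonormalBasis ℂ Vγ j)))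
      (ξ (component (stdOrthonormalBasis ℂ Vγ j) φ))
    filter_upwards [Lp.coeFn_finsetSum Finset.univ fun j =>
      inner ℂ (stdOrthonormalBasis ℂ Vγ i) (S (stdOrthonormalBasis ℂ Vγ j)) •
        ξ (component (stdOrthonormalBasis ℂ Vγ j) φ), h2] with x h1 h2
    rw [h1, Finset.sum_apply]
    exact Finset.sum_congr rfl fun j _ => h2 j
  filter_upwards [ae_all_iff.2 h] with x hx
  simp only [embed, hx, map_sum, map_smul, Finset.sum_smul]
  rw [Finset.sum_comm]
  refine Finset.sum_congr rfl fun j _ => ?_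
  conv_rhs => rw [← (stdOrthonormalBasis ℂ Vγ).sum_repr' (S (stdOrthonormalBasis ℂ Vγ j)),
    Finset.smul_sum]
  exact Finset.sum_congr rfl fun i _ => by rw [smul_smul, mul_comm]

theorem sigma_mul_proj [CompleteSpace Vκ] [CompleteSpace Vγ]
    (ξ : principalSpace κ →ₗᵢ[ℂ] Lp ℂ 2 ν) (φ ψ : sections Vγ κ) (T : Vκ ⊗[ℂ] Vγ)
    (f : C(RightCosets Γ, Vγ →L[ℂ] Vγ)) :
    sigma ξ φ ψ (f * proj Γ T) = sigma ξ φ (mapSection (projEnd T) ψ) f := by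
  refine integral_congr_ae ?_
  filter_upwards [embed_mapSection ξ (projEnd T) ψ] with x hx
  rw [hx]
  rfl

/-- Right translation as a homeomorphism of `Γ\G`. -/
def mulRightHomeomorph (g : G) : RightCosets Γ ≃ₜ RightCosets Γ where
  toFun := RightCosets.mulRight g
  invFun := RightCosets.mulRight g⁻¹
  left_inv x := by rw [mulRight_mulRight, mul_inv_cancel, mulRight_one]
  right_inv x := by rw [mulRight_mulRight, inv_mul_cancel, mulRight_one]
  continuous_toFun := RightCosets.continuous_mulRight g
  continuous_invFun := RightCosets.continuous_mulRight g⁻¹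

theorem IsEmbedding.embed_actSection [CompleteSpace Vγ] {l : Module.Dual ℝ D.𝔞}
    {ξ : principalSpace κ →ₗᵢ[ℂ] Lp ℂ 2 ν} (hξ : IsEmbedding κ l ξ) (φ : sections Vγ κ)
    (h : D.K) : embed ξ (actSection γ h φ) =ᵐ[ν]
      fun x => γ.toHom h (embed ξ φ (x.mulRight (h : G))) := by
  filter_upwards [embed_mapSection ξ (γ.toHom h).toContinuousLinearEquiv.toContinuousLinearMap
    (translateSection h φ), hξ.embed_translateSection φ h] with x h1 h2
  rw [actSection, h1, h2]
  rfl

/-- `σ^ξ_{hφ,hψ}(hf) = σ^ξ_{φ,ψ}(f)` for `h ∈ K`: the unitaries `γ(h)` cancel, and the translation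
of the variable preserves the measure. -/
theorem IsEmbedding.sigma_act [CompleteSpace Vγ] {l : Module.Dual ℝ D.𝔞}
    {ξ : principalSpace κ →ₗᵢ[ℂ] Lp ℂ 2 ν} (hξ : IsEmbedding κ l ξ)
    (hν_inv : ∀ g : G, MeasurePreserving (RightCosets.mulRight (Γ := Γ) g) ν ν)
    (φ ψ : sections Vγ κ) (h : D.K) (f : C(RightCosets Γ, Vγ →L[ℂ] Vγ)) :
    sigma ξ (actSection γ h φ) (actSection γ h ψ) (act (h : G) (γ.toHom h) f) = sigma ξ φ ψ f := by
  have h1 := (hν_inv (h : G)).integral_comp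
    (mulRightHomeomorph (Γ := Γ) (h : G)).measurableEmbedding
    fun x => inner ℂ (embed ξ φ x) (f x (embed ξ ψ x))
  refine Eq.trans (integral_congr_ae ?_) h1
  filter_upwards [hξ.embed_actSection (γ := γ) φ h, hξ.embed_actSection (γ := γ) ψ h] with x hx hx'
  rw [hx, hx', act_apply, LinearIsometryEquiv.inner_map_map, LinearIsometryEquiv.symm_apply_apply]

end Sigma

/-! ### Lifts, and the isomorphism `Φ` -/

/-- States are hermitian, because the values of `σ` at `(a + 1)*(a + 1)` and `(ia + 1)*(ia + 1)` are
real. -/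
theorem IsState.map_star {A : Type*} [Ring A] [StarRing A] [Algebra ℂ A] [StarModule ℂ A]
    [TopologicalSpace A] {σ : A →L[ℂ] ℂ} (hσ : IsState σ) (a : A) :
    σ (star a) = starRingEnd ℂ (σ a) := by
  have him : ∀ b : A, (σ (star b * b)).im = 0 := fun b => (Complex.nonneg_iff.1 (hσ.2 b)).2.symm
  have h1 := him (a + 1)
  have h2 := him (Complex.I • a + 1)
  have h0 := him a
  have e1 : star (a + 1) * (a + 1) = star a * a + star a + a + 1 := by
    rw [star_add, star_one]; noncomm_ring
  have e2 : star (Complex.I • a + 1) * (Complex.I • a + 1) =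
      star a * a + (-Complex.I) • star a + Complex.I • a + 1 := by
    have hI : star Complex.I = -Complex.I := Complex.conj_I
    rw [star_add, star_one, star_smul, hI, add_mul, mul_add, smul_mul_smul_comm, one_mul, mul_one]
    simp only [neg_mul, Complex.I_mul_I, neg_neg, one_smul]
    abel
  rw [e1] at h1
  rw [e2] at h2
  simp only [map_add, map_smul, hσ.1, Complex.add_im, h0, Complex.one_im, smul_eq_mul,
    Complex.mul_im, Complex.neg_re, Complex.neg_im, Complex.I_re, Complex.I_im] at h1 h2
  apply Complex.ext
  · rw [Complex.conj_re]; linarith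
  · rw [Complex.conj_im]; linarith

section Lifts

variable {E : Type*} [NormedAddCommGroup E] [NormedSpace ℝ E] [CompleteSpace E]
  {G : Type*} [TopologicalSpace G] [ChartedSpace E G] [Group G] [LieGroup 𝓘(ℝ, E) ∞ G]
  [IsTopologicalGroup G] [T2Space G] [SecondCountableTopology G] [MeasurableSpace G] [BorelSpace G]
  {D : IwasawaData E G} {Γ : Subgroup G} [CompactSpace (RightCosets Γ)]
  {ν : Measure (RightCosets Γ)}
  {Vκ : Type*} [NormedAddCommGroup Vκ] [InnerProductSpace ℂ Vκ] [FiniteDimensional ℂ Vκ]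
  [CompleteSpace Vκ]
  {Vγ : Type*} [NormedAddCommGroup Vγ] [InnerProductSpace ℂ Vγ] [FiniteDimensional ℂ Vγ]
  [CompleteSpace Vγ]
  {κ : UnitaryRep D.M Vκ} {γ : UnitaryRep D.K Vγ} {l : Module.Dual ℝ D.𝔞} {T : invariants κ γ}
  {σ : C(RightCosets Γ, Vγ →L[ℂ] Vγ) →L[ℂ] ℂ}

/-- The terms of the sums for `σ(mf)` and `σ(f)` agree already along the approximating sequence,
since `ψ_T` and the isotypic parts of `δ_T` are `m`-invariant. -/
theorem lift_act (hν_inv : ∀ g : G, MeasurePreserving (RightCosets.mulRight (Γ := Γ) g) ν ν)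
    (hσ : σ ∈ lifts ν l T) (m : D.M) (f : C(RightCosets Γ, Vγ →L[ℂ] Vγ)) :
    σ (act ((m : D.K) : G) (γ.toHom (m : D.K)) f) = σ f := by
  obtain ⟨-, lam, ξ, δ, hξ, hδ, hf⟩ := hσ
  have hcont := σ.continuous.comp (actL ((m : D.K) : G) (γ.toHom (m : D.K))).continuous
  refine congrFun (hcont.ext_on (dense_isKFinite γ) σ.continuous fun f hfK => ?_) f
  change σ (act ((m : D.K) : G) (γ.toHom (m : D.K)) f) = σ f
  rw [hf _ hfK, hf _ (hfK.act γ (m : D.K))]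
  refine finsum_congr fun χ => ?_
  simp only [sigmaLim]
  congr 1
  funext n
  conv_lhs => rw [← actSection_psi T (m : D.K), ← isIsotypicPart_actSection_eq (hδ χ) m]
  exact (hξ.embedding n).sigma_act hν_inv _ _ _ _

theorem lift_mul_proj (hκ : κ.IsIrreducible) (hT : ‖T‖ = 1) (hσ : σ ∈ lifts ν l T)
    (f : C(RightCosets Γ, Vγ →L[ℂ] Vγ)) : σ (f * proj Γ (T : Vκ ⊗[ℂ] Vγ)) = σ f := by
  obtain ⟨-, lam, ξ, δ, hξ, hδ, hf⟩ := hσ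
  have hcont := σ.continuous.comp (continuous_mul_const (proj Γ (T : Vκ ⊗[ℂ] Vγ)))
  refine congrFun (hcont.ext_on (dense_isKFinite γ) σ.continuous fun f hfK => ?_) f
  change σ (f * proj Γ (T : Vκ ⊗[ℂ] Vγ)) = σ f
  have hfT : IsKFinite γ (f * proj Γ (T : Vκ ⊗[ℂ] Vγ)) := hfK.mul γ (isKFinite_const γ _)
  rw [hf _ hfK, hf _ hfT]
  refine finsum_congr fun χ => ?_
  simp only [sigmaLim]
  congr 1
  funext n
  rw [sigma_mul_proj, isIsotypicPart_mapSection_eq (hδ χ) (projEnd_star _)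
    (lTensor_projEnd hκ hT)]

/-- `ψ_T` is not fixed by `1 ⊗ P_T`, so that the identity is derived from `lift_mul_proj` by taking
adjoints. -/
theorem lift_proj_mul (hκ : κ.IsIrreducible) (hT : ‖T‖ = 1) (hσ : σ ∈ lifts ν l T)
    (f : C(RightCosets Γ, Vγ →L[ℂ] Vγ)) : σ (proj Γ (T : Vκ ⊗[ℂ] Vγ) * f) = σ f := by
  have h1 : star (star f * proj Γ (T : Vκ ⊗[ℂ] Vγ)) = proj Γ (T : Vκ ⊗[ℂ] Vγ) * f :=
    (star_mul (star f) (proj Γ (T : Vκ ⊗[ℂ] Vγ))).trans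
      (congrArg₂ (· * ·) (proj_star (T : Vκ ⊗[ℂ] Vγ)) (star_star f))
  rw [← h1, hσ.1.map_star, lift_mul_proj hκ hT hσ, hσ.1.map_star, starRingEnd_self_apply]

theorem lift_proj_mul_proj (hκ : κ.IsIrreducible) (hT : ‖T‖ = 1) (hσ : σ ∈ lifts ν l T)
    (f : C(RightCosets Γ, Vγ →L[ℂ] Vγ)) :
    σ (proj Γ (T : Vκ ⊗[ℂ] Vγ) * f * proj Γ (T : Vκ ⊗[ℂ] Vγ)) = σ f := by
  rw [lift_mul_proj hκ hT hσ, lift_proj_mul hκ hT hσ]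

/-- A common element `σ` would satisfy `1 = σ(P_T') = σ(P_T P_T' P_T) = |⟨T, T'⟩|²`, against the
strict Cauchy–Schwarz inequality. -/
theorem disjoint_lifts (hκ : κ.IsIrreducible) (hT : ‖T‖ = 1) {T' : invariants κ γ}
    (hT' : ‖T'‖ = 1) (hTT' : LinearIndependent ℂ ![T, T']) (l' : Module.Dual ℝ D.𝔞) :
    Disjoint (lifts ν l T : Set (C(RightCosets Γ, Vγ →L[ℂ] Vγ) →L[ℂ] ℂ)) (lifts ν l' T') := by
  rw [Set.disjoint_left]
  intro σ hσ hσ'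
  have h1 : σ (proj Γ (T : Vκ ⊗[ℂ] Vγ)) = 1 := by
    rw [← mul_one (proj Γ (T : Vκ ⊗[ℂ] Vγ)), lift_proj_mul hκ hT hσ, hσ.1.1]
  have h2 : σ (proj Γ (T' : Vκ ⊗[ℂ] Vγ)) = 1 := by
    rw [← mul_one (proj Γ (T' : Vκ ⊗[ℂ] Vγ)), lift_proj_mul hκ hT' hσ', hσ'.1.1]
  have h3 : proj Γ (T : Vκ ⊗[ℂ] Vγ) * proj Γ (T' : Vκ ⊗[ℂ] Vγ) * proj Γ (T : Vκ ⊗[ℂ] Vγ) =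
      (inner ℂ (T : Vκ ⊗[ℂ] Vγ) (T' : Vκ ⊗[ℂ] Vγ) * inner ℂ (T' : Vκ ⊗[ℂ] Vγ) (T : Vκ ⊗[ℂ] Vγ)) •
        proj Γ (T : Vκ ⊗[ℂ] Vγ) :=
    ContinuousMap.ext fun _ => projEnd_mul_projEnd_mul_projEnd hκ T T'
  have h4 := lift_proj_mul_proj hκ hT hσ (proj Γ (T' : Vκ ⊗[ℂ] Vγ))
  rw [h3, map_smul, h1, h2, smul_eq_mul, mul_one] at h4
  have h5 : ‖(inner ℂ (T : Vκ ⊗[ℂ] Vγ) (T' : Vκ ⊗[ℂ] Vγ) : ℂ)‖ *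
      ‖(inner ℂ (T : Vκ ⊗[ℂ] Vγ) (T' : Vκ ⊗[ℂ] Vγ) : ℂ)‖ = 1 := by
    have h := congrArg norm h4
    rw [norm_mul, norm_one] at h
    exact (congrArg (_ * ·) (norm_inner_symm (𝕜 := ℂ) (T : Vκ ⊗[ℂ] Vγ) (T' : Vκ ⊗[ℂ] Vγ))).trans h
  have hn : ‖(T : Vκ ⊗[ℂ] Vγ)‖ = 1 := hT
  have hn' : ‖(T' : Vκ ⊗[ℂ] Vγ)‖ = 1 := hT'
  have h6 : ‖(inner ℂ (T : Vκ ⊗[ℂ] Vγ) (T' : Vκ ⊗[ℂ] Vγ) : ℂ)‖ =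
      ‖(T : Vκ ⊗[ℂ] Vγ)‖ * ‖(T' : Vκ ⊗[ℂ] Vγ)‖ := by
    rw [hn, hn', mul_one]
    exact (mul_self_eq_one_iff.1 h5).resolve_right
      fun h => by linarith [norm_nonneg (inner ℂ (T : Vκ ⊗[ℂ] Vγ) (T' : Vκ ⊗[ℂ] Vγ) : ℂ)]
  obtain ⟨r, -, hr⟩ := (norm_inner_eq_norm_iff (𝕜 := ℂ) (norm_ne_zero_iff.1 (by rw [hn]; simp))
    (norm_ne_zero_iff.1 (by rw [hn']; simp))).1 h6
  have hr' : T' = r • T := Subtype.ext hr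
  have h7 := (LinearIndependent.pair_iff.1 hTT' r (-1) (by rw [hr']; module)).2
  norm_num at h7

variable (D) in
theorem isProbabilityMeasure_haarM : IsProbabilityMeasure D.haarM :=
  ⟨Measure.haarMeasure_self (K₀ := (⊤ : TopologicalSpace.PositiveCompacts D.M))⟩

instance : D.haarM.IsHaarMeasure := by unfold IwasawaData.haarM; infer_instance

theorem continuous_act_M (f : C(RightCosets Γ, Vγ →L[ℂ] Vγ)) :
    Continuous fun m : D.M => act ((m : D.K) : G) (γ.toHom (m : D.K)) f :=
  (continuous_actRep γ f).comp continuous_subtype_val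

theorem integrable_act_M (f : C(RightCosets Γ, Vγ →L[ℂ] Vγ)) :
    Integrable (fun m : D.M => act ((m : D.K) : G) (γ.toHom (m : D.K)) f) D.haarM :=
  (continuous_act_M f).integrable_of_hasCompactSupport (HasCompactSupport.of_compactSpace _)

theorem act_averageM (f : C(RightCosets Γ, Vγ →L[ℂ] Vγ)) (m : D.M) :
    act ((m : D.K) : G) (γ.toHom (m : D.K)) (averageM γ f) = averageM γ f := by
  rw [← actL_apply, averageM, ← ContinuousLinearMap.integral_comp_comm _ (integrable_act_M f),
    ← integral_mul_left_eq_self (fun m : D.M => act ((m : D.K) : G) (γ.toHom (m : D.K)) f) m]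
  refine integral_congr_ae (.of_forall fun m' => ?_)
  exact (congrArg (fun S => S f) (map_mul (actRep Γ γ) (m : D.K) (m' : D.K))).symm

theorem averageM_eq_self {f : C(RightCosets Γ, Vγ →L[ℂ] Vγ)}
    (hf : ∀ m : D.M, act ((m : D.K) : G) (γ.toHom (m : D.K)) f = f) : averageM γ f = f := by
  have := isProbabilityMeasure_haarM D
  rw [averageM]
  simp only [hf, integral_const, probReal_univ, one_smul]

theorem lift_averageM
    (hν_inv : ∀ g : G, MeasurePreserving (RightCosets.mulRight (Γ := Γ) g) ν ν)
    (hσ : σ ∈ lifts ν l T) (f : C(RightCosets Γ, Vγ →L[ℂ] Vγ)) : σ (averageM γ f) = σ f := by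
  have := isProbabilityMeasure_haarM D
  rw [averageM, ← ContinuousLinearMap.integral_comp_comm _ (integrable_act_M f)]
  simp only [lift_act hν_inv hσ, integral_const, probReal_univ, one_smul]

theorem proj_mul_mul_proj_mem_corner (hκ : κ.IsIrreducible) (hT : ‖T‖ = 1)
    {f : C(RightCosets Γ, Vγ →L[ℂ] Vγ)}
    (hf : ∀ m : D.M, act ((m : D.K) : G) (γ.toHom (m : D.K)) f = f) :
    proj Γ (T : Vκ ⊗[ℂ] Vγ) * f * proj Γ (T : Vκ ⊗[ℂ] Vγ) ∈ corner Γ T := by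
  refine ⟨fun m => by rw [act_mul, act_mul, hf m, act_proj], ?_, ?_⟩
  · rw [← mul_assoc, ← mul_assoc, proj_mul_self hκ hT]
  · rw [mul_assoc, proj_mul_self hκ hT]

end Lifts

section Isomorphism

variable {E : Type*} [NormedAddCommGroup E] [NormedSpace ℝ E] [CompleteSpace E]
  {G : Type*} [TopologicalSpace G] [ChartedSpace E G] [Group G] [LieGroup 𝓘(ℝ, E) ∞ G]
  [IsTopologicalGroup G] [SecondCountableTopology G] [MeasurableSpace G] [BorelSpace G]
  {D : IwasawaData E G} {Γ : Subgroup G}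
  {Vκ : Type*} [NormedAddCommGroup Vκ] [InnerProductSpace ℂ Vκ] [FiniteDimensional ℂ Vκ]
  [CompleteSpace Vκ]
  {Vγ : Type*} [NormedAddCommGroup Vγ] [InnerProductSpace ℂ Vγ] [FiniteDimensional ℂ Vγ]
  [CompleteSpace Vγ]
  {κ : UnitaryRep D.M Vκ} {γ : UnitaryRep D.K Vγ} {T : invariants κ γ}

variable (Γ) in
/-- `f ↦ dim(V_κ) T* f T`, from `A_γ` to `C(Γ\G) ⊗ End(V_κ̃)`. -/
noncomputable def compress (T : Vκ ⊗[ℂ] Vγ) (f : C(RightCosets Γ, Vγ →L[ℂ] Vγ)) :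
    C(RightCosets Γ, DualSpace Vκ →L[ℂ] DualSpace Vκ) where
  toFun x := (Module.finrank ℂ Vκ : ℂ) • (ContinuousLinearMap.adjoint (tensorHom T)).comp
    ((f x).comp (tensorHom T))
  continuous_toFun :=
    (continuous_const_smul _).comp
      (continuous_const.clm_comp (f.continuous.clm_comp continuous_const))

variable (Γ) in
/-- `h ↦ dim(V_κ) T h T*`, from `C(Γ\G) ⊗ End(V_κ̃)` to `A_γ`. -/
noncomputable def dilate (T : Vκ ⊗[ℂ] Vγ) :
    C(RightCosets Γ, DualSpace Vκ →L[ℂ] DualSpace Vκ) →L[ℂ] C(RightCosets Γ, Vγ →L[ℂ] Vγ) where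
  toFun h :=
    { toFun := fun x => (Module.finrank ℂ Vκ : ℂ) • (tensorHom T).comp
        ((h x).comp (ContinuousLinearMap.adjoint (tensorHom T)))
      continuous_toFun :=
        (continuous_const_smul _).comp
          (continuous_const.clm_comp (h.continuous.clm_comp continuous_const)) }
  map_add' a b := by
    ext x v
    exact (congrArg ((Module.finrank ℂ Vκ : ℂ) • ·) (map_add (tensorHom T) _ _)).trans
      (smul_add _ _ _)
  map_smul' c a := by
    ext x v
    exact (congrArg ((Module.finrank ℂ Vκ : ℂ) • ·) (map_smul (tensorHom T) c _)).trans
      (smul_comm _ _ _)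
  cont := by
    have h2 : Continuous fun h : DualSpace Vκ →L[ℂ] DualSpace Vκ =>
        (Module.finrank ℂ Vκ : ℂ) • (tensorHom T).comp
          (h.comp (ContinuousLinearMap.adjoint (tensorHom T))) :=
      (continuous_const_smul _).comp
        (continuous_const.clm_comp (continuous_id.clm_comp continuous_const))
    exact ContinuousMap.continuous_postcomp (X := RightCosets Γ) ⟨_, h2⟩

theorem compress_apply (T : Vκ ⊗[ℂ] Vγ) (f : C(RightCosets Γ, Vγ →L[ℂ] Vγ)) (x : RightCosets Γ)
    (ℓ : DualSpace Vκ) : compress Γ T f x ℓ = (Module.finrank ℂ Vκ : ℂ) •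
      ContinuousLinearMap.adjoint (tensorHom T) (f x (tensorHom T ℓ)) := rfl

theorem dilate_apply (T : Vκ ⊗[ℂ] Vγ) (h : C(RightCosets Γ, DualSpace Vκ →L[ℂ] DualSpace Vκ))
    (x : RightCosets Γ) (v : Vγ) : dilate Γ T h x v = (Module.finrank ℂ Vκ : ℂ) •
      tensorHom T (h x (ContinuousLinearMap.adjoint (tensorHom T) v)) := rfl

theorem proj_apply (T : Vκ ⊗[ℂ] Vγ) (x : RightCosets Γ) (v : Vγ) :
    proj Γ T x v = projEnd T v := rfl

theorem adjoint_tensorHom_smul (hκ : κ.IsIrreducible) (hT : ‖T‖ = 1) (ℓ : DualSpace Vκ) :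
    (Module.finrank ℂ Vκ : ℂ) • ContinuousLinearMap.adjoint (tensorHom (T : Vκ ⊗[ℂ] Vγ))
      (tensorHom (T : Vκ ⊗[ℂ] Vγ) ℓ) = ℓ := by
  rw [adjoint_tensorHom_tensorHom hκ, inner_self_of_norm_eq_one hT, one_smul]

theorem dilate_compress (f : C(RightCosets Γ, Vγ →L[ℂ] Vγ)) :
    dilate Γ (T : Vκ ⊗[ℂ] Vγ) (compress Γ (T : Vκ ⊗[ℂ] Vγ) f) =
      proj Γ (T : Vκ ⊗[ℂ] Vγ) * f * proj Γ (T : Vκ ⊗[ℂ] Vγ) := by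
  ext x v
  change _ = proj Γ (T : Vκ ⊗[ℂ] Vγ) x (f x (proj Γ (T : Vκ ⊗[ℂ] Vγ) x v))
  rw [dilate_apply, compress_apply, proj_apply, proj_apply, projEnd_apply, projEnd_apply]
  simp only [map_smul]

theorem compress_dilate (hκ : κ.IsIrreducible) (hT : ‖T‖ = 1)
    (h : C(RightCosets Γ, DualSpace Vκ →L[ℂ] DualSpace Vκ)) :
    compress Γ (T : Vκ ⊗[ℂ] Vγ) (dilate Γ (T : Vκ ⊗[ℂ] Vγ) h) = h := by
  ext1 x
  refine ContinuousLinearMap.ext fun ℓ => ?_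
  rw [compress_apply, dilate_apply, map_smul, adjoint_tensorHom_smul hκ hT, ← map_smul,
    adjoint_tensorHom_smul hκ hT]

theorem dilate_mul (hκ : κ.IsIrreducible) (hT : ‖T‖ = 1)
    (h h' : C(RightCosets Γ, DualSpace Vκ →L[ℂ] DualSpace Vκ)) :
    dilate Γ (T : Vκ ⊗[ℂ] Vγ) (h * h') =
      dilate Γ (T : Vκ ⊗[ℂ] Vγ) h * dilate Γ (T : Vκ ⊗[ℂ] Vγ) h' := by
  ext x v
  change _ = dilate Γ (T : Vκ ⊗[ℂ] Vγ) h x (dilate Γ (T : Vκ ⊗[ℂ] Vγ) h' x v)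
  rw [dilate_apply, dilate_apply, dilate_apply, map_smul, adjoint_tensorHom_smul hκ hT]
  rfl

theorem dilate_star (h : C(RightCosets Γ, DualSpace Vκ →L[ℂ] DualSpace Vκ)) :
    dilate Γ (T : Vκ ⊗[ℂ] Vγ) (star h) = star (dilate Γ (T : Vκ ⊗[ℂ] Vγ) h) := by
  ext x v
  refine ext_inner_left ℂ fun w => ?_
  change _ = inner ℂ w (ContinuousLinearMap.adjoint (dilate Γ (T : Vκ ⊗[ℂ] Vγ) h x) v)
  rw [ContinuousLinearMap.adjoint_inner_right, dilate_apply, dilate_apply, inner_smul_left,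
    inner_smul_right, ← ContinuousLinearMap.adjoint_inner_left]
  change _ * inner ℂ _ (ContinuousLinearMap.adjoint (h x) _) = _
  rw [ContinuousLinearMap.adjoint_inner_right, ContinuousLinearMap.adjoint_inner_right]
  simp

theorem dilate_one : dilate Γ (T : Vκ ⊗[ℂ] Vγ) 1 = proj Γ (T : Vκ ⊗[ℂ] Vγ) := rfl

theorem act_dilate (m : D.M) (h : C(RightCosets Γ, DualSpace Vκ →L[ℂ] DualSpace Vκ)) :
    act ((m : D.K) : G) (γ.toHom (m : D.K)) (dilate Γ (T : Vκ ⊗[ℂ] Vγ) h) =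
      dilate Γ (T : Vκ ⊗[ℂ] Vγ) (act ((m : D.K) : G) (κ.dual m) h) := by
  ext x v
  rw [act_apply, dilate_apply, dilate_apply, act_apply, tensorHom_dual, map_smul]
  congr 5
  rw [LinearIsometryEquiv.eq_symm_apply, ← adjoint_tensorHom_apply,
    LinearIsometryEquiv.apply_symm_apply]

theorem dilate_mem_corner (hκ : κ.IsIrreducible) (hT : ‖T‖ = 1)
    {h : C(RightCosets Γ, DualSpace Vκ →L[ℂ] DualSpace Vκ)} (hh : h ∈ bundleSections κ Γ) :
    dilate Γ (T : Vκ ⊗[ℂ] Vγ) h ∈ corner Γ T :=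
  ⟨fun m => by rw [act_dilate, hh m],
    by rw [← dilate_one, ← dilate_mul hκ hT]; exact congrArg _ (one_mul h),
    by rw [← dilate_one, ← dilate_mul hκ hT]; exact congrArg _ (mul_one h)⟩

theorem dilate_compress_of_mem_corner {f : C(RightCosets Γ, Vγ →L[ℂ] Vγ)} (hf : f ∈ corner Γ T) :
    dilate Γ (T : Vκ ⊗[ℂ] Vγ) (compress Γ (T : Vκ ⊗[ℂ] Vγ) f) = f := by
  rw [dilate_compress, hf.2.1, hf.2.2]

theorem compress_mem_bundleSections (hκ : κ.IsIrreducible) (hT : ‖T‖ = 1)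
    {f : C(RightCosets Γ, Vγ →L[ℂ] Vγ)} (hf : f ∈ corner Γ T) :
    compress Γ (T : Vκ ⊗[ℂ] Vγ) f ∈ bundleSections κ Γ := by
  intro m
  rw [← compress_dilate hκ hT (act _ _ _), ← act_dilate, dilate_compress_of_mem_corner hf, hf.1 m]

/-- The isomorphism from `P_T A_γ^M P_T` onto `C(Γ\G ×_M End(V_κ̃))`. -/
noncomputable def cornerEquiv (hκ : κ.IsIrreducible) (hT : ‖T‖ = 1) :
    corner Γ T ≃⋆ₐ[ℂ] bundleSections κ Γ :=
  StarAlgEquiv.symm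
  { toFun := fun h => ⟨dilate Γ (T : Vκ ⊗[ℂ] Vγ) h, dilate_mem_corner hκ hT h.2⟩
    invFun := fun c => ⟨compress Γ (T : Vκ ⊗[ℂ] Vγ) c, compress_mem_bundleSections hκ hT c.2⟩
    left_inv := fun _ => Subtype.ext (compress_dilate hκ hT _)
    right_inv := fun c => Subtype.ext (dilate_compress_of_mem_corner c.2)
    map_mul' := fun _ _ => Subtype.ext (dilate_mul hκ hT _ _)
    map_add' := fun _ _ => Subtype.ext (map_add _ _ _)
    map_star' := fun _ => Subtype.ext (dilate_star _)
    map_smul' := fun _ _ => Subtype.ext (map_smul _ _ _) }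

theorem cornerEquiv_coe (hκ : κ.IsIrreducible) (hT : ‖T‖ = 1) (c : corner Γ T) :
    (cornerEquiv hκ hT c : C(RightCosets Γ, DualSpace Vκ →L[ℂ] DualSpace Vκ)) =
      compress Γ (T : Vκ ⊗[ℂ] Vγ) c := rfl

end Isomorphism

/-! ### The induced state -/

section InducedState

variable {E : Type*} [NormedAddCommGroup E] [NormedSpace ℝ E] [CompleteSpace E]
  {G : Type*} [TopologicalSpace G] [ChartedSpace E G] [Group G] [LieGroup 𝓘(ℝ, E) ∞ G]
  [IsTopologicalGroup G] [T2Space G] [SecondCountableTopology G] [MeasurableSpace G] [BorelSpace G]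
  {D : IwasawaData E G} {Γ : Subgroup G} [CompactSpace (RightCosets Γ)]
  {ν : Measure (RightCosets Γ)}
  {Vκ : Type*} [NormedAddCommGroup Vκ] [InnerProductSpace ℂ Vκ] [FiniteDimensional ℂ Vκ]
  [CompleteSpace Vκ]
  {Vγ : Type*} [NormedAddCommGroup Vγ] [InnerProductSpace ℂ Vγ] [FiniteDimensional ℂ Vγ]
  [CompleteSpace Vγ]
  {κ : UnitaryRep D.M Vκ} {γ : UnitaryRep D.K Vγ} {l : Module.Dual ℝ D.𝔞} {T : invariants κ γ}
  {σ : C(RightCosets Γ, Vγ →L[ℂ] Vγ) →L[ℂ] ℂ}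

variable (σ T) in
/-- The functional `h ↦ σ(dim(V_κ) T h T*)` on `C(Γ\G ×_M End(V_κ̃))`. -/
noncomputable def inducedFunctional : bundleSections κ Γ →L[ℂ] ℂ where
  toFun h := σ (dilate Γ (T : Vκ ⊗[ℂ] Vγ) h.1)
  map_add' a b := by
    rw [← map_add, ← map_add]; rfl
  map_smul' c a := by
    rw [RingHom.id_apply, ← map_smul, ← map_smul]; rfl
  cont := (σ.continuous.comp (dilate Γ (T : Vκ ⊗[ℂ] Vγ)).continuous).comp continuous_subtype_val

theorem inducedFunctional_apply (h : bundleSections κ Γ) :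
    inducedFunctional T σ h = σ (dilate Γ (T : Vκ ⊗[ℂ] Vγ) h.1) := rfl

theorem isState_inducedFunctional (hκ : κ.IsIrreducible) (hT : ‖T‖ = 1) (hσ : σ ∈ lifts ν l T) :
    IsState (inducedFunctional T σ) := by
  constructor
  · change σ (proj Γ (T : Vκ ⊗[ℂ] Vγ)) = 1
    rw [← mul_one (proj Γ (T : Vκ ⊗[ℂ] Vγ)), lift_proj_mul hκ hT hσ, hσ.1.1]
  · intro h
    have h1 : dilate Γ (T : Vκ ⊗[ℂ] Vγ) (star h * h).1 =
        star (dilate Γ (T : Vκ ⊗[ℂ] Vγ) h.1) * dilate Γ (T : Vκ ⊗[ℂ] Vγ) h.1 := by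
      rw [← dilate_star, ← dilate_mul hκ hT]; rfl
    rw [inducedFunctional_apply, h1]
    exact hσ.1.2 _

theorem existsUnique_inducedState (hκ : κ.IsIrreducible) (hT : ‖T‖ = 1)
    (hν_inv : ∀ g : G, MeasurePreserving (RightCosets.mulRight (Γ := Γ) g) ν ν)
    (hσ : σ ∈ lifts ν l T) :
    ∃! σ₀ : bundleSections κ Γ →L[ℂ] ℂ, IsState σ₀ ∧
      ∀ f : C(RightCosets Γ, Vγ →L[ℂ] Vγ), ∃ c : corner Γ T,
        (c : C(RightCosets Γ, Vγ →L[ℂ] Vγ)) =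
          proj Γ (T : Vκ ⊗[ℂ] Vγ) * averageM γ f * proj Γ (T : Vκ ⊗[ℂ] Vγ) ∧
        σ f = σ₀ (cornerEquiv hκ hT c) := by
  refine ⟨inducedFunctional T σ, ⟨isState_inducedFunctional hκ hT hσ, fun f => ?_⟩, ?_⟩
  · refine ⟨⟨_, proj_mul_mul_proj_mem_corner hκ hT (act_averageM f)⟩, rfl, ?_⟩
    rw [inducedFunctional_apply, cornerEquiv_coe, dilate_compress_of_mem_corner
      (proj_mul_mul_proj_mem_corner hκ hT (act_averageM f)), lift_proj_mul_proj hκ hT hσ,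
      lift_averageM hν_inv hσ]
  · rintro σ₁ ⟨-, hσ₁⟩
    refine ContinuousLinearMap.ext fun h => ?_
    -- the element `f = Φ⁻¹(h)` is `M`-invariant and satisfies `P_T f P_T = f`
    have hmem := dilate_mem_corner (γ := γ) (T := T) hκ hT h.2
    obtain ⟨c, hc, hσc⟩ := hσ₁ (dilate Γ (T : Vκ ⊗[ℂ] Vγ) h.1)
    rw [averageM_eq_self hmem.1, hmem.2.1, hmem.2.2] at hc
    have hh : cornerEquiv hκ hT c = h := Subtype.ext (by
      rw [cornerEquiv_coe, hc, compress_dilate hκ hT])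
    rw [inducedFunctional_apply, hσc, hh]

end InducedState

end RepLift

open RepLift in
theorem mainTheorem7
    {E : Type*} [NormedAddCommGroup E] [NormedSpace ℝ E] [FiniteDimensional ℝ E] [CompleteSpace E]
    {G : Type*} [TopologicalSpace G] [ChartedSpace E G] [Group G] [LieGroup 𝓘(ℝ, E) ∞ G]
    [IsTopologicalGroup G] [T2Space G] [SecondCountableTopology G]
    [MeasurableSpace G] [BorelSpace G]
    [LieAlgebra.IsSemisimple ℝ (GroupLieAlgebra 𝓘(ℝ, E) G)]
    (D : IwasawaData E G)
    (Γ : Subgroup G) [DiscreteTopology Γ] [CompactSpace (RightCosets Γ)]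
    (hΓ : ∀ g ∈ Γ, IsOfFinOrder g → g = 1)
    (ν : Measure (RightCosets Γ)) [IsFiniteMeasure ν] (hν : ν ≠ 0)
    (hν_inv : ∀ g : G, MeasurePreserving (RightCosets.mulRight (Γ := Γ) g) ν ν)
    {Vκ : Type*} [NormedAddCommGroup Vκ] [InnerProductSpace ℂ Vκ] [FiniteDimensional ℂ Vκ]
    [CompleteSpace Vκ] (κ : UnitaryRep D.M Vκ) (hκ : κ.IsIrreducible)
    {Vγ : Type*} [NormedAddCommGroup Vγ] [InnerProductSpace ℂ Vγ] [FiniteDimensional ℂ Vγ]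
    [CompleteSpace Vγ] (γ : UnitaryRep D.K Vγ)
    (l : Module.Dual ℝ D.𝔞) (hl : l ∈ limitRays κ ν) (hl_reg : D.IsRegular l)
    (T : invariants κ γ) (hT : ‖T‖ = 1) :
    (IsStarProjection (proj Γ (T : Vκ ⊗[ℂ] Vγ)) ∧
      ∀ m : D.M, act ((m : D.K) : G) (γ.toHom (m : D.K)) (proj Γ (T : Vκ ⊗[ℂ] Vγ)) =
        proj Γ (T : Vκ ⊗[ℂ] Vγ)) ∧
    (∀ σ ∈ lifts ν l T,
      (∀ (m : D.M) (f : C(RightCosets Γ, Vγ →L[ℂ] Vγ)),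
        σ (act ((m : D.K) : G) (γ.toHom (m : D.K)) f) = σ f) ∧
      (∀ f : C(RightCosets Γ, Vγ →L[ℂ] Vγ),
        σ (proj Γ (T : Vκ ⊗[ℂ] Vγ) * f * proj Γ (T : Vκ ⊗[ℂ] Vγ)) = σ f)) ∧
    (∃ Φ : corner Γ T ≃⋆ₐ[ℂ] bundleSections κ Γ,
      (∀ (c : corner Γ T) (x : RightCosets Γ),
        (Φ c : C(RightCosets Γ, DualSpace Vκ →L[ℂ] DualSpace Vκ)) x =
          (Module.finrank ℂ Vκ : ℂ) •
            (ContinuousLinearMap.adjoint (tensorHom (T : Vκ ⊗[ℂ] Vγ))).comp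
              (((c : C(RightCosets Γ, Vγ →L[ℂ] Vγ)) x).comp (tensorHom (T : Vκ ⊗[ℂ] Vγ)))) ∧
      ∀ σ ∈ lifts ν l T, ∃! σ₀ : bundleSections κ Γ →L[ℂ] ℂ, IsState σ₀ ∧
        ∀ f : C(RightCosets Γ, Vγ →L[ℂ] Vγ), ∃ c : corner Γ T,
          (c : C(RightCosets Γ, Vγ →L[ℂ] Vγ)) =
            proj Γ (T : Vκ ⊗[ℂ] Vγ) * averageM γ f * proj Γ (T : Vκ ⊗[ℂ] Vγ) ∧
          σ f = σ₀ (Φ c)) ∧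
    (∀ l' ∈ limitRays κ ν, D.IsRegular l' → ∀ T' : invariants κ γ, ‖T'‖ = 1 →
      LinearIndependent ℂ ![T, T'] → Disjoint (lifts ν l T) (lifts ν l' T')) := by
  refine ⟨⟨isStarProjection_proj hκ hT, act_proj T⟩,
    fun σ hσ => ⟨lift_act hν_inv hσ, lift_proj_mul_proj hκ hT hσ⟩,
    ⟨cornerEquiv hκ hT, fun c x => rfl, fun σ hσ => existsUnique_inducedState hκ hT hν_inv hσ⟩,
    fun l' _ _ T' hT' hTT' => disjoint_lifts hκ hT hT' hTT' l'⟩
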